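/- Let $\mathbb D$ be the open unit disc, $\mathbb T$ the unit circle with normalized Lebesgue measure $m$, and for $1\le p\le\infty$ let $L^p=L^p(\mathbb T,m)$ (complex valued). Let $H^p\subseteq L^p$ be the Hardy space of those $f\in L^p$ whose Fourier coefficients of negative index vanish, and let $H^p_0\subseteq H^p$ be the subspace of functions of mean value zero. Let $\Gamma$ be a group of (holomorphic) automorphisms of $\mathbb D$; each $\gamma\in\Gamma$ has the form $\gamma(z)=\lambda\frac{a-z}{1-\bar a z}$ with $|\lambda|=1$, $|a|<1$, and so also acts on $\mathbb T$. For a subspace $X\subseteq L^p$ put $X_\Gamma=\{f\in X: f\circ\gamma=f \text{ a.e. for all }\gamma\in\Gamma\}$; in particular $L^p_\Gamma$, $H^p_\Gamma$ and $H^p_{0,\Gamma}=(H^p_0)_\Gamma$ are defined. Let $\Psi:L^p\to L^p$ be the conditional expectation onto the $\sigma$-algebra of measurable sets $E\subseteq\mathbb T$ with $m(E\,\triangle\,\gamma^{-1}(E))=0$ for all $\gamma\in\Gamma$. With the Szegő kernel $k_w(z)=(1-\bar w z)^{-1}$ put $v_\gamma=-i\,\Psi\big(k_{\gamma(0)}-\overline{k_{\gamma(0)}}\big)\in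 L^\infty$ for $\gamma\in\Gamma$, and let the defect space $N$ be the complex linear span of $\{v_\gamma:\gamma\in\Gamma\}$. The group $\Gamma$ is called admissible if it is of convergence type, that is, $\sum_{\gamma\in\Gamma}(1-|\gamma(0)|)<\infty$, and $N$ is finite dimensional. Let $\Gamma$ be admissible. Then: (a) For every $1\le p\le\infty$, $\Psi(H^p)=H^p_\Gamma+N$. (b) Let $1\le p<\infty$ and $\frac1p+\frac1q=1$. The map $g\mapsto\big(f\mapsto\int fg\,dm\big)$ is an isometric linear isomorphism of $L^q_\Gamma$ onto the dual $(L^p_\Gamma)^*$. For $X\subseteq L^p_\Gamma$ let $X^\perp=\{g\in L^q_\Gamma:\int fg\,dm=0\ \text{for all } f\in X\}$, and for $Y\subseteq L^q_\Gamma$ let $Y_\perp=\{f\in L^p_\Gamma:\int fg\,dm=0\ \text{for all } g\in Y\}$. Then 1. $(H^p_\Gamma)^\perp=H^q_{0,\Gamma}+N$; 2. $(H^q_\Gamma)_\perp=H^p_{0,\Gamma}+N$; 3. $(H^q_\Gamma+N)_\perp=H^p_{0,\Gamma}$; 4. $(H^p_\Gamma+N)^\perp=H^q_{0,\Gamma}$.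 -/

import Mathlib

open MeasureTheory Complex
open scoped ENNReal ComplexConjugate Real UnitDisc

noncomputable section

namespace FuchsianHardy

/-! ### Automorphisms of the disc and their action on the circle -/

/-- The holomorphic self-maps of the open unit disc, as complex-valued functions on the disc. -/
def IsHolomorphic (e : 𝔻 → 𝔻) : Prop :=
  ∃ F : ℂ → ℂ, DifferentiableOn ℂ F (Metric.ball 0 1) ∧ ∀ z : 𝔻, F z = e z

/-- The group (under composition) of automorphisms of the disc: the holomorphic bijections of the
disc with holomorphic inverse. -/
def diskAut : Subgroup (Equiv.Perm 𝔻) where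
  carrier := {e | IsHolomorphic e ∧ IsHolomorphic e.symm}
  one_mem' := ⟨⟨id, differentiableOn_id, fun _ => rfl⟩, ⟨id, differentiableOn_id, fun _ => rfl⟩⟩
  inv_mem' := fun h => ⟨h.2, h.1⟩
  mul_mem' := by
    have key : ∀ e₁ e₂ : 𝔻 → 𝔻, IsHolomorphic e₁ → IsHolomorphic e₂ →
        IsHolomorphic (fun z => e₁ (e₂ z)) := by
      rintro e₁ e₂ ⟨F, hF, hFe⟩ ⟨G, hG, hGe⟩
      refine ⟨F ∘ G, hF.comp hG ?_, fun z => ?_⟩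
      · intro z hz
        have hz' : ‖z‖ < 1 := by simpa using hz
        have := hGe (UnitDisc.mk z hz')
        rw [UnitDisc.coe_mk] at this
        rw [this]
        simpa using UnitDisc.norm_lt_one _
      · simp only [Function.comp_apply, hGe, hFe]
    rintro e₁ e₂ ⟨h₁, h₁'⟩ ⟨h₂, h₂'⟩
    exact ⟨key e₁ e₂ h₁ h₂, key e₂.symm e₁.symm h₂' h₁'⟩

/-- The simple Blaschke factor `z ↦ (a - z) / (1 - conj a * z)`. -/
def blaschke (a z : ℂ) : ℂ := (a - z) / (1 - conj a * z)

theorem one_sub_ne_zero {a z : ℂ} (ha : ‖a‖ < 1) (hz : ‖z‖ ≤ 1) : 1 - conj a * z ≠ 0 := by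
  intro h
  have h1 : ‖conj a * z‖ = 1 := by rw [← sub_eq_zero.1 h, norm_one]
  rw [norm_mul, RCLike.norm_conj] at h1
  nlinarith [norm_nonneg a, norm_nonneg z]

theorem normSq_identity (a z : ℂ) :
    normSq (1 - conj a * z) - normSq (a - z) = (1 - normSq a) * (1 - normSq z) := by
  simp only [normSq_apply, sub_re, sub_im, one_re, one_im, mul_re, mul_im, conj_re, conj_im]
  ring

theorem norm_blaschke_lt_one {a z : ℂ} (ha : ‖a‖ < 1) (hz : ‖z‖ < 1) : ‖blaschke a z‖ < 1 := by
  have hne := one_sub_ne_zero ha hz.le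
  rw [blaschke, norm_div, div_lt_one (norm_pos_iff.2 hne)]
  have h := normSq_identity a z
  simp only [normSq_eq_norm_sq] at h
  have h1 : 0 < (1 - ‖a‖ ^ 2) * (1 - ‖z‖ ^ 2) :=
    mul_pos (by nlinarith [norm_nonneg a]) (by nlinarith [norm_nonneg z])
  exact lt_of_pow_lt_pow_left₀ 2 (norm_nonneg _) (by linarith)

theorem norm_blaschke_eq_one {a z : ℂ} (ha : ‖a‖ < 1) (hz : ‖z‖ = 1) : ‖blaschke a z‖ = 1 := by
  have hne := one_sub_ne_zero ha hz.le
  rw [blaschke, norm_div, div_eq_one_iff_eq (norm_ne_zero_iff.2 hne)]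
  have h := normSq_identity a z
  simp only [normSq_eq_norm_sq, hz] at h
  exact (pow_left_inj₀ (norm_nonneg _) (norm_nonneg _) two_ne_zero).1 (by linarith)

theorem blaschke_blaschke {a z : ℂ} (ha : ‖a‖ < 1) (hz : ‖z‖ ≤ 1) :
    blaschke a (blaschke a z) = z := by
  have hne := one_sub_ne_zero ha hz
  have hna := one_sub_ne_zero ha ha.le
  have h2 : 1 - conj a * ((a - z) / (1 - conj a * z)) =
      (1 - conj a * a) / (1 - conj a * z) := by
    rw [eq_div_iff hne, sub_mul, mul_assoc, div_mul_cancel₀ _ hne]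
    ring
  have h1 : a - (a - z) / (1 - conj a * z) = z * (1 - conj a * a) / (1 - conj a * z) := by
    rw [eq_div_iff hne, sub_mul, div_mul_cancel₀ _ hne]
    ring
  unfold blaschke
  rw [h1, h2, div_div_div_cancel_right₀ hne, mul_div_cancel_right₀ _ hna]

theorem differentiableOn_blaschke {a : ℂ} (ha : ‖a‖ < 1) :
    DifferentiableOn ℂ (blaschke a) (Metric.ball 0 1) := by
  intro z hz
  have hne := one_sub_ne_zero ha (z := z) (by simpa using (mem_ball_zero_iff.1 hz).le)
  unfold blaschke
  exact (DifferentiableAt.fun_div (c := fun z => a - z) (d := fun z => 1 - conj a * z)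
    (by fun_prop) (by fun_prop) hne).differentiableWithinAt

/-- Every automorphism is a rotation of a simple Blaschke factor. -/
theorem diskAut_form (e : diskAut) :
    ∃ lam : Circle, ∀ z : 𝔻, ((e.1 z : 𝔻) : ℂ) = lam * blaschke (e.1.symm 0 : 𝔻) z := by
  obtain ⟨e, ⟨F, hF, hFe⟩, ⟨F', hF', hFe'⟩⟩ := e
  set a : ℂ := ((e.symm 0 : 𝔻) : ℂ) with ha_def
  have ha : ‖a‖ < 1 := UnitDisc.norm_lt_one _
  have hlift : ∀ z : ℂ, z ∈ Metric.ball (0 : ℂ) 1 → ∃ w : 𝔻, (w : ℂ) = z := fun z hz =>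
    ⟨UnitDisc.mk z (by simpa using hz), rfl⟩
  have hb : Set.MapsTo (blaschke a) (Metric.ball 0 1) (Metric.ball 0 1) := fun z hz => by
    simpa using norm_blaschke_lt_one ha (by simpa using hz)
  have hFm : Set.MapsTo F (Metric.ball 0 1) (Metric.ball 0 1) := fun z hz => by
    obtain ⟨w, rfl⟩ := hlift z hz
    simpa [hFe] using UnitDisc.norm_lt_one _
  have hFm' : Set.MapsTo F' (Metric.ball 0 1) (Metric.ball 0 1) := fun z hz => by
    obtain ⟨w, rfl⟩ := hlift z hz
    simpa [hFe'] using UnitDisc.norm_lt_one _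
  have hFF' : ∀ z ∈ Metric.ball (0 : ℂ) 1, F' (F z) = z := fun z hz => by
    obtain ⟨w, rfl⟩ := hlift z hz
    rw [hFe, hFe', Equiv.symm_apply_apply]
  have hF'0 : F' 0 = a := by simpa using hFe' 0
  have hFa : F a = 0 := by simpa using hFe (e.symm 0)
  have hb0 : blaschke a 0 = a := by simp [blaschke]
  have hba : blaschke a a = 0 := by simp [blaschke]
  set G : ℂ → ℂ := F ∘ blaschke a with hG
  set H : ℂ → ℂ := blaschke a ∘ F' with hH
  have hG0 : G 0 = 0 := by simp [hG, hb0, hFa]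
  have hH0 : H 0 = 0 := by simp [hH, hF'0, hba]
  have hGd : DifferentiableOn ℂ G (Metric.ball 0 1) := hF.comp (differentiableOn_blaschke ha) hb
  have hHd : DifferentiableOn ℂ H (Metric.ball 0 1) :=
    (differentiableOn_blaschke ha).comp hF' hFm'
  have hGm : Set.MapsTo G (Metric.ball 0 1) (Metric.ball 0 1) := hFm.comp hb
  have hHm : Set.MapsTo H (Metric.ball 0 1) (Metric.ball 0 1) := hb.comp hFm'
  have hz₀ : ((1 / 2 : ℝ) : ℂ) ∈ Metric.ball (0 : ℂ) 1 := by
    simp; norm_num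
  have hHG : H (G (1 / 2 : ℝ)) = ((1 / 2 : ℝ) : ℂ) := by
    simp only [hG, hH, Function.comp_apply]
    rw [hFF' _ (hb hz₀), blaschke_blaschke ha (mem_ball_zero_iff.1 hz₀).le]
  have h1 : ‖G (1 / 2 : ℝ)‖ ≤ ‖((1 / 2 : ℝ) : ℂ)‖ :=
    norm_le_norm_of_mapsTo_ball hGd (hGm.mono_right Metric.ball_subset_closedBall) hG0
      (mem_ball_zero_iff.1 hz₀)
  have h2 : ‖((1 / 2 : ℝ) : ℂ)‖ ≤ ‖G (1 / 2 : ℝ)‖ := by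
    have := norm_le_norm_of_mapsTo_ball hHd (hHm.mono_right Metric.ball_subset_closedBall) hH0
      (mem_ball_zero_iff.1 (hGm hz₀))
    rwa [hHG] at this
  obtain ⟨C, hC, hGC⟩ := affine_of_mapsTo_ball_of_exists_norm_dslope_eq_div' hGd
    (by rw [hG0]; exact hGm.mono_right Metric.ball_subset_closedBall)
    ⟨_, hz₀, by
      have hne : ((1 / 2 : ℝ) : ℂ) ≠ 0 := by simp
      rw [dslope_of_ne _ hne, slope_def_field, hG0, sub_zero, sub_zero, norm_div,
        le_antisymm h1 h2, div_self (norm_ne_zero_iff.2 hne), div_one]⟩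
  refine ⟨⟨C, by simpa [Submonoid.unitSphere] using hC⟩, fun z => ?_⟩
  have hz : (z : ℂ) ∈ Metric.ball (0 : ℂ) 1 := by simpa using z.norm_lt_one
  have h3 := hGC (hb hz)
  simp only [hG, Function.comp_apply, blaschke_blaschke ha z.norm_lt_one.le] at h3
  change ((e z : 𝔻) : ℂ) = C * blaschke a z
  rw [← hFe z, h3, hb0, hFa]
  simp [mul_comm]

/-- The unimodular constant of an automorphism. -/
def unimod (e : diskAut) : Circle := (diskAut_form e).choose

/-- The action of an automorphism on the unit circle, by its formula
`z ↦ lam * (a - z) / (1 - conj a * z)`, where `a` is the preimage of `0`. -/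
def bdry (e : diskAut) (z : Circle) : Circle :=
  unimod e * ⟨blaschke (e.1.symm 0 : 𝔻) z, by
    simpa [Submonoid.unitSphere] using
      norm_blaschke_eq_one (UnitDisc.norm_lt_one _) (Circle.norm_coe z)⟩

/-! ### Lebesgue measure on the circle -/

instance : MeasurableSpace Circle := borel Circle

instance : BorelSpace Circle := ⟨rfl⟩

/-- Normalized Lebesgue (arc length) measure on the unit circle. -/
def m : Measure Circle :=
  (ENNReal.ofReal (2 * π))⁻¹ • (volume.restrict (Set.Ioc (-π) π)).map Circle.exp

theorem measurable_exp : Measurable (Circle.exp : ℝ → Circle) :=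
  Circle.exp.continuous.measurable

instance : IsProbabilityMeasure m := by
  constructor
  rw [m, Measure.smul_apply, Measure.map_apply measurable_exp MeasurableSet.univ]
  simp only [Set.preimage_univ, Measure.restrict_apply_univ, Real.volume_Ioc, smul_eq_mul]
  rw [show π - -π = 2 * π by ring]
  exact ENNReal.inv_mul_cancel (by simp [Real.pi_pos]) ENNReal.ofReal_ne_top

theorem m_eq_zero_iff {s : Set Circle} (hs : MeasurableSet s) :
    m s = 0 ↔ volume (Circle.exp ⁻¹' s ∩ Set.Ioc (-π) π) = 0 := by
  rw [m, Measure.smul_apply, Measure.map_apply measurable_exp hs,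
    Measure.restrict_apply (measurable_exp hs), smul_eq_mul, mul_eq_zero]
  simp [ENNReal.mul_eq_top]

theorem coe_bdry (e : diskAut) (z : Circle) :
    (bdry e z : ℂ) = unimod e * blaschke (e.1.symm 0 : 𝔻) z := rfl

theorem continuous_bdry (e : diskAut) : Continuous (bdry e) := by
  refine continuous_induced_rng.2 ?_
  change Continuous fun z : Circle => ((unimod e : ℂ) * blaschke (e.1.symm 0 : 𝔻) z)
  unfold blaschke
  refine continuous_const.mul (Continuous.div (by fun_prop) (by fun_prop) fun z => ?_)
  exact one_sub_ne_zero (UnitDisc.norm_lt_one _) (Circle.norm_coe z).le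

/-- Automorphisms preserve Lebesgue null sets of the circle, so that composition with them is
well defined on classes of functions modulo null sets. -/
theorem quasiMeasurePreserving_bdry (e : diskAut) :
    Measure.QuasiMeasurePreserving (bdry e) m m := by
  have hmeas := (continuous_bdry e).measurable
  refine ⟨hmeas, Measure.AbsolutelyContinuous.mk fun s hs h0 => ?_⟩
  rw [Measure.map_apply hmeas hs, m_eq_zero_iff (hmeas hs)]
  rw [m_eq_zero_iff hs] at h0
  set a : ℂ := ((e.1.symm 0 : 𝔻) : ℂ) with ha_def
  have ha : ‖a‖ < 1 := UnitDisc.norm_lt_one _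
  set l : ℂ := (unimod e : ℂ) with hl
  have hl0 : l ≠ 0 := Circle.coe_ne_zero _
  set inv : ℝ → ℂ := fun u => blaschke a (l⁻¹ * Circle.exp u) with hinv
  set g : ℝ → ℝ := fun u => (Complex.log (inv u)).im with hg
  set A : Set ℝ := (Circle.exp ⁻¹' s ∩ Set.Ioc (-π) π) ∩ {u | inv u ∈ slitPlane} with hA
  have hA0 : volume A = 0 := measure_mono_null Set.inter_subset_left h0
  have hgd : DifferentiableOn ℝ g A := by
    intro u hu
    have hd : DifferentiableAt ℝ inv u := by
      have hne : 1 - conj a * (l⁻¹ * Complex.exp (u * I)) ≠ 0 :=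
        one_sub_ne_zero ha (by
          rw [norm_mul, norm_inv, hl, Circle.norm_coe, Complex.norm_exp_ofReal_mul_I]; simp)
      simp only [hinv, Circle.coe_exp, blaschke]
      have h1 : DifferentiableAt ℝ (fun u : ℝ => Complex.exp (u * I)) u := by
        have : DifferentiableAt ℝ (fun u : ℝ => (u : ℂ)) u := Complex.ofRealCLM.differentiableAt
        fun_prop
      exact DifferentiableAt.div (by fun_prop) (by fun_prop) hne
    have h2 : DifferentiableAt ℝ Complex.log (inv u) :=
      (Complex.differentiableAt_log hu.2).restrictScalars ℝ
    exact (Complex.imCLM.differentiableAt.comp u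
      (h2.comp u hd)).differentiableWithinAt
  have himg := addHaar_image_eq_zero_of_differentiableOn_of_addHaar_eq_zero volume hgd hA0
  refine measure_mono_null (t := g '' A ∪ {π}) ?_ (measure_union_null himg (by simp))
  rintro t ⟨hts, ht⟩
  by_cases htp : t = π
  · exact Or.inr htp
  have hkey : inv (Complex.arg (bdry e (Circle.exp t))) = Circle.exp t := by
    change blaschke a (l⁻¹ * Circle.exp (Complex.arg (bdry e (Circle.exp t)))) = Circle.exp t
    rw [Circle.exp_arg, coe_bdry, inv_mul_cancel_left₀ hl0,
      blaschke_blaschke ha (Circle.norm_coe _).le]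
  refine Or.inl ⟨Complex.arg (bdry e (Circle.exp t)), ?_, ?_⟩
  · refine ⟨⟨?_, Complex.arg_mem_Ioc _⟩, ?_⟩
    · simpa [Circle.exp_arg] using hts
    · change inv _ ∈ slitPlane
      rw [hkey, Complex.mem_slitPlane_iff_arg]
      refine ⟨?_, Circle.coe_ne_zero _⟩
      rw [Circle.arg_exp ht.1 ht.2]
      exact htp
  · change (Complex.log (inv _)).im = t
    rw [hkey, Complex.log_im, Circle.arg_exp ht.1 ht.2]

/-! ### Lebesgue and Hardy spaces of a group of automorphisms -/

/-- The subspace of `Γ`-invariant elements of `L^p`: those with `f ∘ γ = f` for all `γ ∈ Γ`. -/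
def LpInv (Γ : Subgroup diskAut) (p : ℝ≥0∞) : Submodule ℂ (Lp ℂ p m) where
  carrier := {f | ∀ γ ∈ Γ, (fun z => f (bdry γ z)) =ᵐ[m] f}
  zero_mem' := fun γ _ => by
    have h := Lp.coeFn_zero ℂ p m
    exact ((quasiMeasurePreserving_bdry γ).ae_eq_comp h).trans (by simpa using h.symm)
  add_mem' := fun {f g} hf hg γ hγ => by
    have h := Lp.coeFn_add f g
    filter_upwards [(quasiMeasurePreserving_bdry γ).ae_eq_comp h, h, hf γ hγ, hg γ hγ]
      with z h1 h2 h3 h4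
    simp only [Function.comp_apply, Pi.add_apply] at h1 h2
    rw [h1, h2, h3, h4]
  smul_mem' := fun c f hf γ hγ => by
    have h := Lp.coeFn_smul c f
    filter_upwards [(quasiMeasurePreserving_bdry γ).ae_eq_comp h, h, hf γ hγ] with z h1 h2 h3
    simp only [Function.comp_apply, Pi.smul_apply] at h1 h2
    rw [h1, h2, h3]

/-- The elements of `L^p` whose Fourier coefficients of index `< n₀` vanish. -/
def fourierVanish (p : ℝ≥0∞) [Fact (1 ≤ p)] (n₀ : ℤ) : Submodule ℂ (Lp ℂ p m) where
  carrier := {f | ∀ n : ℤ, n < n₀ → ∫ z, ((z ^ (-n) : Circle) : ℂ) * f z ∂m = 0}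
  zero_mem' := fun n _ => by
    rw [← integral_zero Circle ℂ (μ := m)]
    refine integral_congr_ae ?_
    filter_upwards [Lp.coeFn_zero ℂ p m] with z hz
    rw [hz, Pi.zero_apply, mul_zero]
  add_mem' := fun {f g} hf hg n hn => by
    have hc : Continuous fun z : Circle => (z : ℂ) := by fun_prop
    have hint : ∀ f : Lp ℂ p m, Integrable (fun z => ((z ^ (-n) : Circle) : ℂ) * f z) m :=
      fun f => ((Lp.memLp f).integrable Fact.out).bdd_mul (c := 1)
        (Continuous.aestronglyMeasurable (hc.comp (continuous_zpow (-n))))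
        (ae_of_all _ fun z => (Circle.norm_coe _).le)
    rw [← add_zero (0 : ℂ)]
    nth_rewrite 1 [← hf n hn]
    rw [← hg n hn, ← integral_add (hint f) (hint g)]
    refine integral_congr_ae ?_
    filter_upwards [Lp.coeFn_add f g] with z hz
    rw [hz, Pi.add_apply, mul_add]
  smul_mem' := fun c f hf n hn => by
    rw [← mul_zero c, ← hf n hn, ← integral_const_mul]
    refine integral_congr_ae ?_
    filter_upwards [Lp.coeFn_smul c f] with z hz
    simp [hz]
    ring

/-- The Hardy space `H^p`, as a subspace of `L^p` of the circle. -/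
def Hp (p : ℝ≥0∞) [Fact (1 ≤ p)] : Submodule ℂ (Lp ℂ p m) := fourierVanish p 0

/-- The space `H^p_0` of the functions in `H^p` of mean value zero. -/
def Hp0 (p : ℝ≥0∞) [Fact (1 ≤ p)] : Submodule ℂ (Lp ℂ p m) := fourierVanish p 1

/-- `H^p_Γ`, the `Γ`-invariant elements of `H^p`. -/
def HpInv (Γ : Subgroup diskAut) (p : ℝ≥0∞) [Fact (1 ≤ p)] : Submodule ℂ (Lp ℂ p m) :=
  Hp p ⊓ LpInv Γ p

/-- `H^p_{0,Γ}`, the `Γ`-invariant elements of `H^p_0`. -/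
def Hp0Inv (Γ : Subgroup diskAut) (p : ℝ≥0∞) [Fact (1 ≤ p)] : Submodule ℂ (Lp ℂ p m) :=
  Hp0 p ⊓ LpInv Γ p

/-! ### The conditional expectation and the defect space -/

/-- The sigma-algebra of the measurable sets `E` with `m (E ∆ γ⁻¹ E) = 0` for all `γ ∈ Γ`. -/
@[reducible]
def invSigma (Γ : Subgroup diskAut) : MeasurableSpace Circle where
  MeasurableSet' E := MeasurableSet E ∧ ∀ γ ∈ Γ, m (symmDiff E (bdry γ ⁻¹' E)) = 0
  measurableSet_empty := ⟨MeasurableSet.empty, by simp⟩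
  measurableSet_compl := fun E ⟨hE, h⟩ => ⟨hE.compl, fun γ hγ => by
    rw [Set.preimage_compl, compl_symmDiff_compl]
    exact h γ hγ⟩
  measurableSet_iUnion := fun E hE => ⟨MeasurableSet.iUnion fun i => (hE i).1, fun γ hγ => by
    rw [measure_symmDiff_eq_zero_iff, Set.preimage_iUnion]
    exact Filter.EventuallyEq.countable_iUnion fun i =>
      measure_symmDiff_eq_zero_iff.1 ((hE i).2 γ hγ)⟩

/-- The conditional expectation `Ψ` on `L^p` with respect to the `Γ`-invariant sets. -/
def Psi (Γ : Subgroup diskAut) (p : ℝ≥0∞) [Fact (1 ≤ p)] (f : Lp ℂ p m) : Lp ℂ p m :=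
  ((Lp.memLp f).condExp (m := invSigma Γ) Fact.out).toLp (m[f | invSigma Γ])

/-- The Szegő kernel `k_w` on the circle. -/
def szego (w : 𝔻) (z : Circle) : ℂ := 1 / (1 - conj (w : ℂ) * z)

theorem continuous_szego (w : 𝔻) : Continuous (szego w) := by
  unfold szego
  exact Continuous.div (by fun_prop) (by fun_prop)
    fun z => one_sub_ne_zero w.norm_lt_one (Circle.norm_coe z).le

theorem memLp_szego_sub (w : 𝔻) (p : ℝ≥0∞) :
    MemLp (fun z => szego w z - conj (szego w z)) p m := by
  have hc : Continuous fun z => szego w z - conj (szego w z) :=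
    (continuous_szego w).sub (continuous_conj.comp (continuous_szego w))
  obtain ⟨C, hC⟩ := isCompact_univ.exists_bound_of_continuousOn hc.continuousOn
  exact MemLp.of_bound hc.aestronglyMeasurable C (ae_of_all _ fun z => hC z (Set.mem_univ z))

/-- `v_γ = -i Ψ(k_{γ(0)} - conj k_{γ(0)})`. -/
def defectVec (Γ : Subgroup diskAut) (p : ℝ≥0∞) [Fact (1 ≤ p)] (γ : diskAut) : Lp ℂ p m :=
  (-I) • Psi Γ p ((memLp_szego_sub (γ.1 0) p).toLp _)

/-- The defect space `N`, the linear span of the bounded functions `v_γ`, `γ ∈ Γ`, as a subspace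
of `L^p`. -/
def defectSpace (Γ : Subgroup diskAut) (p : ℝ≥0∞) [Fact (1 ≤ p)] : Submodule ℂ (Lp ℂ p m) :=
  Submodule.span ℂ {v | ∃ γ ∈ Γ, v = defectVec Γ p γ}

/-- `Γ` is of convergence type: the sum of `1 - |γ(0)|` over `γ ∈ Γ` is finite. -/
def IsConvergenceType (Γ : Subgroup diskAut) : Prop :=
  Summable fun γ : Γ => 1 - ‖((γ.1.1 0 : 𝔻) : ℂ)‖

/-- `Γ` is admissible: it is of convergence type and the defect space is finite dimensional. -/
def IsAdmissible (Γ : Subgroup diskAut) : Prop :=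
  IsConvergenceType Γ ∧ FiniteDimensional ℂ (defectSpace Γ ∞)

/-- For a set `X ⊆ L^p`, the set of the `g ∈ L^q_Γ` with `∫ f g dm = 0` for all `f ∈ X`. For
conjugate exponents and `p < ∞` this is the annihilator of `X` in `L^q_Γ`; with the roles of
the exponents exchanged it is the preannihilator. -/
def annih (Γ : Subgroup diskAut) {p : ℝ≥0∞} (q : ℝ≥0∞) (X : Set (Lp ℂ p m)) :
    Set (Lp ℂ q m) :=
  {g | g ∈ LpInv Γ q ∧ ∀ f ∈ X, ∫ z, f z * g z ∂m = 0}

end FuchsianHardy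

end

open FuchsianHardy

/-! Everything rests on the change of variables `∫ f ∘ γ dm = ∫ P f dm`, where `P = k + conj k - 1`
is the Poisson kernel at `γ(0)` and `k` the Szegő kernel there (`map_bdry`, `integral_comp_bdry`).
It gives `Ψ P = 1`, hence `v_γ = -2i Ψ(k - 1)` (`defectVec_eq`). So `N` lies in `Ψ(H^p)`, and it
annihilates `H^p_Γ`.

For the converse inclusion in (a), `H^1_Γ + N` is closed because `N` is finite dimensional. By
Hahn-Banach it suffices that an invariant bounded `G` annihilating `H^1_Γ` and `N` lies in `H^∞_0`.
In `L^2` split `G = a + b` with `a` analytic and `b` antianalytic of mean zero. Invariance reads `b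
∘ γ - b = a - a ∘ γ`. The left side has no positive frequencies and the right side no negative ones,
so both are a constant, namely the mean of `b ∘ γ`; orthogonality to `N` makes it zero. Hence `b` is
invariant, `conj b` lies in `H^2_Γ`, and `∫ |b|^2 = ∫ conj b * G = 0` (`mem_Hp0_two`). Other
exponents follow from `p = 1` because `N` consists of bounded functions.

For (b), `Ψ` is self-adjoint for the pairing, so an invariant function annihilates `Ψ(H^p) = H^p_Γ +
N` exactly when it annihilates `H^p`, that is, when it lies in `H^q_0`. If `g` annihilates only
`H^p_Γ`, some `n` in `N` makes `g - n` annihilate `N` as well: the radical of the pairing on `N`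
lies in `H^∞_{0,Γ}`, where `g` vanishes, so finite dimensional linear algebra supplies `n`
(`exists_defect_sub_orthogonal`). The duality itself is the Riesz theorem for `L^p`, cut down by the
contraction `Ψ`. -/

noncomputable section

namespace FuchsianHardy

/-! ### Harmonic analysis on the circle -/

/-- The continuous function `z ↦ z ^ n` on the circle. -/
def monomial (n : ℤ) : C(Circle, ℂ) where
  toFun z := ((z ^ n : Circle) : ℂ)
  continuous_toFun := by
    have hc : Continuous fun z : Circle => (z : ℂ) := by fun_prop
    exact hc.comp (continuous_zpow n)

@[simp]
theorem monomial_apply (n : ℤ) (z : Circle) : monomial n z = ((z ^ n : Circle) : ℂ) := rfl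

theorem continuous_coe_zpow (n : ℤ) : Continuous fun z : Circle => ((z ^ n : Circle) : ℂ) :=
  (monomial n).continuous

/-- Trigonometric polynomials are dense in the continuous functions; the density is transported from
`AddCircle (2 * π)`. -/
theorem clm_eq_zero_of_monomial (Φ : C(Circle, ℂ) →L[ℂ] ℂ) (h : ∀ n, Φ (monomial n) = 0) :
    Φ = 0 := by
  have : Fact (0 < 2 * π) := ⟨Real.two_pi_pos⟩
  let e := AddCircle.homeomorphCircle (T := 2 * π) Real.two_pi_pos.ne'
  let T : C(AddCircle (2 * π), ℂ) →L[ℂ] C(Circle, ℂ) :=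
    ContinuousLinearMap.mk (ContinuousMap.compRightAlgHom ℂ ℂ ⟨e.symm, e.symm.continuous⟩).toLinearMap
      (ContinuousMap.continuous_precomp _)
  have hT : ∀ n, T (fourier n) = monomial n := fun n => by
    ext z
    change (fourier n (e.symm z)) = _
    obtain ⟨x, rfl⟩ := e.surjective z
    rw [e.symm_apply_apply, fourier_apply, monomial_apply, AddCircle.toCircle_zsmul]
    rw [AddCircle.homeomorphCircle_apply]
  have hle : (Submodule.span ℂ (Set.range (@fourier (2 * π)))).topologicalClosure ≤
      LinearMap.ker (Φ ∘L T).toLinearMap := by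
    refine Submodule.topologicalClosure_minimal _ ?_ (Φ ∘L T).isClosed_ker
    rw [Submodule.span_le]
    rintro _ ⟨n, rfl⟩
    change Φ (T (fourier n)) = 0
    rw [hT, h]
  rw [span_fourier_closure_eq_top] at hle
  ext f
  have h1 := hle (Submodule.mem_top (x := f.comp ⟨e, e.continuous⟩))
  have h2 : T (f.comp ⟨e, e.continuous⟩) = f := by
    ext z
    change f (e (e.symm z)) = f z
    rw [e.apply_symm_apply]
  change Φ (T _) = 0 at h1
  rw [h2] at h1
  exact h1

theorem integrable_of_continuous {μ : Measure Circle} [IsFiniteMeasure μ] {f : Circle → ℂ}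
    (hf : Continuous f) : Integrable f μ := by
  obtain ⟨C, hC⟩ := isCompact_univ.exists_bound_of_continuousOn hf.continuousOn
  exact Integrable.of_bound hf.aestronglyMeasurable C (ae_of_all _ fun z => hC z (Set.mem_univ z))

theorem memLp_of_continuous {f : Circle → ℂ} (hf : Continuous f) (p : ℝ≥0∞) : MemLp f p m := by
  obtain ⟨C, hC⟩ := isCompact_univ.exists_bound_of_continuousOn hf.continuousOn
  exact MemLp.of_bound hf.aestronglyMeasurable C (ae_of_all _ fun z => hC z (Set.mem_univ z))

theorem integrable_continuous_mul {f φ : Circle → ℂ} (hf : Integrable f m) (hφ : Continuous φ) :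
    Integrable (fun z => φ z * f z) m := by
  obtain ⟨C, hC⟩ := isCompact_univ.exists_bound_of_continuousOn hφ.continuousOn
  exact hf.bdd_mul (c := C) hφ.aestronglyMeasurable (ae_of_all _ fun z => hC z (Set.mem_univ z))

/-- Integration of continuous functions against an integrable weight. -/
def integralWeight (μ : Measure Circle) [IsFiniteMeasure μ] (f : Circle → ℂ)
    (hf : Integrable f μ) : C(Circle, ℂ) →L[ℂ] ℂ :=
  LinearMap.mkContinuous
    { toFun := fun φ => ∫ z, φ z * f z ∂μ
      map_add' := fun φ ψ => by
        have h : ∀ φ : C(Circle, ℂ), Integrable (fun z => φ z * f z) μ := fun φ =>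
          hf.bdd_mul (c := ‖φ‖) φ.continuous.aestronglyMeasurable
            (ae_of_all _ fun z => φ.norm_coe_le_norm z)
        rw [← integral_add (h φ) (h ψ)]
        simp [add_mul]
      map_smul' := fun c φ => by
        simp [mul_assoc, integral_const_mul] }
    (∫ z, ‖f z‖ ∂μ) fun φ => by
      refine (norm_integral_le_integral_norm _).trans ?_
      rw [← integral_mul_const]
      refine integral_mono_of_nonneg (ae_of_all _ fun z => norm_nonneg _) (hf.norm.mul_const _)
        (ae_of_all _ fun z => ?_)
      change ‖φ z * f z‖ ≤ _
      rw [norm_mul]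
      rw [mul_comm]
      exact mul_le_mul_of_nonneg_left (φ.norm_coe_le_norm z) (norm_nonneg _)

theorem integralWeight_apply (μ : Measure Circle) [IsFiniteMeasure μ] (f : Circle → ℂ)
    (hf : Integrable f μ) (φ : C(Circle, ℂ)) :
    integralWeight μ f hf φ = ∫ z, φ z * f z ∂μ := rfl

/-- An integrable function is determined by its Fourier coefficients. -/
theorem ae_eq_zero_of_fourier {f : Circle → ℂ} (hf : Integrable f m)
    (h : ∀ n : ℤ, ∫ z, ((z ^ n : Circle) : ℂ) * f z ∂m = 0) : f =ᵐ[m] 0 := by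
  have h0 := clm_eq_zero_of_monomial (integralWeight m f hf) fun n => h n
  -- This fact gives `Circle` its smooth structure, so that vanishing a.e. can be tested on smooth
  -- real functions.
  have : Fact (Module.finrank ℝ ℂ = 1 + 1) := finrank_real_complex_fact'
  refine ae_eq_zero_of_integral_contMDiff_smul_eq_zero (modelWithCornersSelf ℝ (EuclideanSpace ℝ (Fin 1))) hf.locallyIntegrable fun g hg _ => ?_
  have := DFunLike.congr_fun h0 ⟨fun z => (g z : ℂ), by have := hg.continuous; fun_prop⟩
  simpa [integralWeight_apply] using this

/-- A finite measure on the circle is determined by its Fourier coefficients. -/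
theorem measure_ext_of_fourier {μ ν : Measure Circle} [IsFiniteMeasure μ] [IsFiniteMeasure ν]
    (h : ∀ n : ℕ, ∫ z : Circle, (z : ℂ) ^ n ∂μ = ∫ z : Circle, (z : ℂ) ^ n ∂ν) : μ = ν := by
  have h0 := clm_eq_zero_of_monomial
    (integralWeight μ 1 (integrable_of_continuous continuous_one) -
      integralWeight ν 1 (integrable_of_continuous continuous_one)) fun n => by
    simp only [sub_apply, integralWeight_apply, monomial_apply, Pi.one_apply,
      mul_one]
    rw [sub_eq_zero]
    obtain ⟨k, rfl | rfl⟩ := n.eq_nat_or_neg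
    · simpa using h k
    -- The measures are positive, so the coefficients of negative exponent are conjugates of those
    -- of positive exponent.
    · simp only [zpow_neg, zpow_natCast, Circle.coe_inv_eq_conj, Circle.coe_pow]
      rw [integral_conj, integral_conj, h k]
  refine ext_of_forall_integral_eq_of_IsFiniteMeasure fun f => ?_
  have h1 := DFunLike.congr_fun h0 ⟨fun z => (f z : ℂ), by fun_prop⟩
  simp only [sub_apply, integralWeight_apply, Pi.one_apply, mul_one,
    ContinuousMap.coe_mk, zero_apply, sub_eq_zero] at h1
  rw [integral_complex_ofReal, integral_complex_ofReal] at h1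
  exact_mod_cast h1

theorem integral_m_eq_circleAverage {F : ℂ → ℂ} (hF : ContinuousOn F (Metric.sphere 0 1)) :
    ∫ z : Circle, F z ∂m = Real.circleAverage F 0 1 := by
  have hc : Continuous fun z : Circle => F z :=
    hF.comp_continuous (by fun_prop) fun z => mem_sphere_zero_iff_norm.2 (Circle.norm_coe z)
  rw [m, integral_smul_measure, integral_map measurable_exp.aemeasurable hc.aestronglyMeasurable]
  rw [Real.circleAverage_def]
  have h2 := (periodic_circleMap (0 : ℂ) 1).comp F |>.intervalIntegral_add_eq 0 (-π)
  simp only [Function.comp_apply, zero_add] at h2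
  rw [h2, show -π + 2 * π = π by ring, intervalIntegral.integral_of_le (by linarith [Real.pi_pos])]
  simp [circleMap, Real.pi_pos.le]

theorem integral_m_of_diffContOnCl {F : ℂ → ℂ} (hF : DiffContOnCl ℂ F (Metric.ball 0 1)) :
    ∫ z : Circle, F z ∂m = F 0 := by
  rw [integral_m_eq_circleAverage, DiffContOnCl.circleAverage (by simpa using hF)]
  refine hF.continuousOn.mono ?_
  rw [closure_ball _ one_ne_zero]
  exact Metric.sphere_subset_closedBall

theorem integral_coe_pow {n : ℕ} (hn : n ≠ 0) : ∫ z : Circle, (z : ℂ) ^ n ∂m = 0 := by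
  rw [integral_m_of_diffContOnCl (F := fun z => z ^ n) (by
    exact (differentiable_id.pow n).diffContOnCl)]
  simp [hn]

/-! ### Rotation invariance -/

/-- Both measures have all moments of positive order equal to zero. Rotation invariance makes `m` a
Haar measure, which is needed for rotations to act continuously on `L^p`. -/
theorem map_mul_left_m (t : Circle) : m.map (fun z => t * z) = m := by
  have hc : Continuous fun z : Circle => t * z := by fun_prop
  have : IsProbabilityMeasure (m.map (fun z => t * z)) :=
    Measure.isProbabilityMeasure_map hc.measurable.aemeasurable
  refine measure_ext_of_fourier fun n => ?_
  rw [integral_map hc.measurable.aemeasurable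
    (Continuous.aestronglyMeasurable (by fun_prop))]
  rcases eq_or_ne n 0 with rfl | hn
  · simp
  · simp only [Circle.coe_mul, mul_pow]
    rw [integral_const_mul, integral_coe_pow hn, mul_zero]

instance : m.IsMulLeftInvariant := ⟨map_mul_left_m⟩

instance : m.IsHaarMeasure :=
  Measure.isHaarMeasure_of_isCompact_nonempty_interior m Set.univ isCompact_univ
    (by simp) (by simp) (by simp)

/-! ### Products of functions with one-sided spectrum -/

theorem integrable_coe {p : ℝ≥0∞} [Fact (1 ≤ p)] (f : Lp ℂ p m) : Integrable f m :=
  (Lp.memLp f).integrable Fact.out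

theorem integrable_mul_of_holderConjugate {p q : ℝ≥0∞} [ENNReal.HolderConjugate p q]
    (f : Lp ℂ p m) (g : Lp ℂ q m) : Integrable (fun z => f z * g z) m :=
  memLp_one_iff_integrable.1 ((Lp.memLp g).mul (Lp.memLp f) (p := p) (q := q) (r := 1))

/-- Fubini and rotation invariance turn the Fourier coefficients of a correlation into products.
This replaces Parseval's identity outside `L^2`. -/
theorem integral_monomial_mul_correlation {f g : Circle → ℂ} (hf : Integrable f m)
    (hg : Integrable g m) (n : ℤ) :
    ∫ t, ((t ^ n : Circle) : ℂ) * ∫ z, f (t * z) * g z ∂m ∂m =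
      (∫ z, ((z ^ n : Circle) : ℂ) * f z ∂m) * ∫ z, ((z ^ (-n) : Circle) : ℂ) * g z ∂m := by
  have h1 : Integrable (fun x : Circle × Circle => f (x.1 * x.2) * g x.2) (m.prod m) :=
    (measurePreserving_mul_prod m m).integrable_comp_of_integrable (hf.mul_prod hg)
  have h2 : Integrable (fun x : Circle × Circle =>
      ((x.1 ^ n : Circle) : ℂ) * (f (x.1 * x.2) * g x.2)) (m.prod m) :=
    h1.bdd_mul (c := 1) ((continuous_coe_zpow n).comp continuous_fst).aestronglyMeasurable
      (ae_of_all _ fun x => (Circle.norm_coe _).le)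
  simp_rw [← integral_const_mul]
  rw [integral_integral_swap h2]
  refine integral_congr_ae (ae_of_all _ fun z => ?_)
  have h3 : ∀ t : Circle, ((t ^ n : Circle) : ℂ) * (f (t * z) * g z) =
      (((t * z) ^ n : Circle) * f (t * z)) * (((z ^ (-n) : Circle) : ℂ) * g z) := fun t => by
    have : t ^ n = (t * z) ^ n * z ^ (-n) := by
      rw [mul_zpow, zpow_neg, mul_inv_cancel_right]
    rw [this, Circle.coe_mul]
    ring
  simp_rw [h3]
  rw [integral_mul_const, integral_mul_right_eq_self (fun s : Circle => ((s ^ n : Circle) : ℂ) * f s)]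

/-- The correlation `c t = ∫ f (t z) g z` is continuous, since rotations act continuously on `L^p`
for `p < ∞`. As `a + b = 1`, at each frequency one of the two factors of its coefficient vanishes.
So `c = 0`, and `c 1` is the integral in question. -/
theorem integral_mul_eq_zero_of_ne_top {p q : ℝ≥0∞} [Fact (1 ≤ p)] [Fact (1 ≤ q)]
    [ENNReal.HolderConjugate p q] (hp : p ≠ ∞) {a b : ℤ} (hab : a + b = 1) {f : Lp ℂ p m}
    {g : Lp ℂ q m} (hf : f ∈ fourierVanish p a) (hg : g ∈ fourierVanish q b) :
    ∫ z, f z * g z ∂m = 0 := by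
  have : Fact (p ≠ ∞) := ⟨hp⟩
  let c : Circle → ℂ := fun t =>
    (ContinuousLinearMap.mul ℂ ℂ).lpPairing m p q (DomMulAct.mk t • f) g
  have hc : Continuous c := by
    have h1 : Continuous fun t : Circle => DomMulAct.mk t • f :=
      (continuous_id.smul continuous_const : Continuous fun t : Circleᵈᵐᵃ => t • f).comp
        DomMulAct.continuous_mk
    have h2 : Continuous fun h : Lp ℂ p m =>
        (ContinuousLinearMap.mul ℂ ℂ).lpPairing m p q h g :=
      (((ContinuousLinearMap.mul ℂ ℂ).lpPairing m p q).flip g).continuous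
    exact h2.comp h1
  have hcv : ∀ t, c t = ∫ z, f (t * z) * g z ∂m := fun t => by
    simp only [c, ContinuousLinearMap.lpPairing_eq_integral]
    refine integral_congr_ae ?_
    filter_upwards [DomMulAct.smul_Lp_ae_eq (DomMulAct.mk t) f] with z hz
    rw [hz]
    rfl
  have hc0 : c =ᵐ[m] 0 := by
    refine ae_eq_zero_of_fourier (integrable_of_continuous hc) fun n => ?_
    simp_rw [hcv]
    rw [integral_monomial_mul_correlation (integrable_coe f) (integrable_coe g)]
    rcases lt_or_ge n b with h | h
    · rw [hg n h, mul_zero]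
    · have := hf (-n) (by omega)
      rw [neg_neg] at this
      rw [this, zero_mul]
  -- A Haar measure charges every nonempty open set, so a continuous function vanishing a.e.
  -- vanishes at the point `1` too.
  have hc1 : c = 0 := Continuous.ae_eq_iff_eq m hc continuous_zero |>.1 hc0
  have h1 := hcv 1
  rw [hc1] at h1
  simpa using h1.symm

/-- Functions of conjugate Lebesgue spaces whose product has no Fourier coefficient at `0` are
orthogonal for the bilinear pairing. -/
theorem integral_mul_eq_zero {p q : ℝ≥0∞} [Fact (1 ≤ p)] [Fact (1 ≤ q)]
    [hpq : ENNReal.HolderConjugate p q] {a b : ℤ} (hab : a + b = 1) {f : Lp ℂ p m}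
    {g : Lp ℂ q m} (hf : f ∈ fourierVanish p a) (hg : g ∈ fourierVanish q b) :
    ∫ z, f z * g z ∂m = 0 := by
  by_cases hp : p = ∞
  · have hq : q ≠ ∞ := by
      rintro rfl
      have := hpq.inv_add_inv_eq_inv
      simp [hp] at this
    have : ENNReal.HolderConjugate q p := hpq.symm
    rw [← integral_mul_eq_zero_of_ne_top hq (by omega) hg hf]
    simp_rw [mul_comm]
  · exact integral_mul_eq_zero_of_ne_top hp hab hf hg

theorem fourierVanish_anti {p : ℝ≥0∞} [Fact (1 ≤ p)] {a b : ℤ} (hab : a ≤ b) :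
    fourierVanish p b ≤ fourierVanish p a := fun _ hf n hn => hf n (hn.trans_le hab)

theorem mem_fourierVanish_toLp {p : ℝ≥0∞} [Fact (1 ≤ p)] {a : ℤ} {f : Circle → ℂ}
    (hf : MemLp f p m) : hf.toLp f ∈ fourierVanish p a ↔
      ∀ n : ℤ, n < a → ∫ z, ((z ^ (-n) : Circle) : ℂ) * f z ∂m = 0 := by
  refine forall₂_congr fun n _ => ?_
  rw [integral_congr_ae]
  filter_upwards [hf.coeFn_toLp] with z hz
  rw [hz]

/-- Boundary values of holomorphic functions vanishing at `0`. -/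
theorem mem_fourierVanish_one_of_diffContOnCl {p : ℝ≥0∞} [Fact (1 ≤ p)] {F : ℂ → ℂ}
    (hF : DiffContOnCl ℂ F (Metric.ball 0 1)) (h0 : F 0 = 0)
    (hFp : MemLp (fun z : Circle => F z) p m) : hFp.toLp _ ∈ fourierVanish p 1 := by
  rw [mem_fourierVanish_toLp]
  intro n hn
  obtain ⟨k, hk⟩ : ∃ k : ℕ, -n = k := ⟨(-n).toNat, by omega⟩
  have h1 : DiffContOnCl ℂ (fun z => z ^ k * F z) (Metric.ball 0 1) :=
    (differentiable_id.pow k).diffContOnCl.smul hF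
  rw [hk]
  have h2 := integral_m_of_diffContOnCl h1
  rw [h0, mul_zero] at h2
  simpa using h2

theorem continuous_of_diffContOnCl {F : ℂ → ℂ} (hF : DiffContOnCl ℂ F (Metric.ball 0 1)) :
    Continuous fun z : Circle => F z := by
  refine hF.continuousOn.comp_continuous (by fun_prop) fun z => ?_
  rw [closure_ball _ one_ne_zero, mem_closedBall_zero_iff]
  exact (Circle.norm_coe z).le

theorem integral_diffContOnCl_mul_eq_zero {p : ℝ≥0∞} [Fact (1 ≤ p)] {F : ℂ → ℂ}
    (hF : DiffContOnCl ℂ F (Metric.ball 0 1)) (h0 : F 0 = 0) {f : Lp ℂ p m}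
    (hf : f ∈ fourierVanish p 0) : ∫ z : Circle, F z * f z ∂m = 0 := by
  have : ENNReal.HolderConjugate p p.conjExponent := .conjExponent Fact.out
  have : Fact (1 ≤ p.conjExponent) := ⟨ENNReal.HolderConjugate.one_le _ p⟩
  have hFp := memLp_of_continuous (continuous_of_diffContOnCl hF) p.conjExponent
  rw [← integral_mul_eq_zero (by norm_num) hf (mem_fourierVanish_one_of_diffContOnCl hF h0 hFp)]
  refine integral_congr_ae ?_
  filter_upwards [hFp.coeFn_toLp] with z hz
  rw [hz, mul_comm]

/-! ### The Poisson kernel and composition with automorphisms -/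

theorem sub_ne_zero_of_norm {w : 𝔻} (z : Circle) : (z : ℂ) - w ≠ 0 := by
  intro h
  have h1 := w.norm_lt_one
  rw [← sub_eq_zero.1 h, Circle.norm_coe] at h1
  exact lt_irrefl _ h1

theorem conj_szego (w : 𝔻) (z : Circle) : conj (szego w z) = z / (z - w) := by
  have hz := Circle.coe_ne_zero z
  rw [szego, map_div₀, map_one, map_sub, map_one, map_mul, conj_conj, ← Circle.coe_inv_eq_conj,
    Circle.coe_inv, div_eq_div_iff _ (sub_ne_zero_of_norm z)]
  · field_simp
  · have := sub_ne_zero_of_norm (w := w) z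
    contrapose! this
    field_simp at this
    rwa [mul_zero] at this

/-- This ties the Szegő kernels in the defect vectors to the density of the pushforward of `m` under
an automorphism. -/
theorem szego_add_conj (w : 𝔻) (z : Circle) :
    szego w z + conj (szego w z) - 1 = poissonKernel 0 w z := by
  have hz := Circle.coe_ne_zero z
  have h1 := sub_ne_zero_of_norm (w := w) z
  have h2 := one_sub_ne_zero w.norm_lt_one (Circle.norm_coe z).le
  rw [conj_szego, szego, poissonKernel]
  push_cast
  simp only [sub_zero, ← Complex.mul_conj', map_sub]
  rw [← Circle.coe_inv_eq_conj, Circle.coe_inv]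
  have h3 : (z : ℂ)⁻¹ - conj (w : ℂ) ≠ 0 := by
    contrapose! h2
    rw [← sub_eq_zero.1 h2, inv_mul_cancel₀ hz, sub_self]
  field_simp
  ring

theorem poissonKernel_nonneg (w : 𝔻) (z : Circle) : 0 ≤ poissonKernel 0 w z := by
  have := w.norm_lt_one
  have := norm_nonneg (w : ℂ)
  simp only [poissonKernel, sub_zero, Circle.norm_coe]
  apply div_nonneg _ (by positivity)
  nlinarith

theorem continuous_poissonKernel (w : 𝔻) : Continuous fun z : Circle => poissonKernel 0 w z := by
  simp only [poissonKernel, sub_zero]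
  exact Continuous.div (by fun_prop) (by fun_prop) fun z =>
    pow_ne_zero 2 (norm_ne_zero_iff.2 (sub_ne_zero_of_norm z))

theorem diffContOnCl_pow {F : ℂ → ℂ} {s : Set ℂ} (hF : DiffContOnCl ℂ F s) (n : ℕ) :
    DiffContOnCl ℂ (fun z => F z ^ n) s :=
  ⟨hF.differentiableOn.pow n, hF.continuousOn.pow n⟩

theorem diffContOnCl_blaschke {a : ℂ} (ha : ‖a‖ < 1) :
    DiffContOnCl ℂ (blaschke a) (Metric.ball 0 1) := by
  refine ⟨differentiableOn_blaschke ha, ?_⟩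
  rw [closure_ball _ one_ne_zero]
  unfold blaschke
  exact ContinuousOn.div (by fun_prop) (by fun_prop) fun z hz =>
    one_sub_ne_zero ha (mem_closedBall_zero_iff.1 hz)

theorem coe_apply_zero (γ : diskAut) :
    ((γ.1 0 : 𝔻) : ℂ) = unimod γ * ((γ.1.symm 0 : 𝔻) : ℂ) := by
  have := (diskAut_form γ).choose_spec 0
  rw [this, UnitDisc.coe_zero, blaschke]
  simp [unimod]

/-- Both measures have `n`-th moment `γ(0) ^ n`: the pushforward by the mean value property of the
holomorphic function `γ ^ n`, the other by the Poisson formula for `z ^ n`. -/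
theorem map_bdry (γ : diskAut) :
    m.map (bdry γ) = m.withDensity fun z => ENNReal.ofReal (poissonKernel 0 (γ.1 0 : 𝔻) z) := by
  have hb := (continuous_bdry γ).measurable
  have hP := continuous_poissonKernel (γ.1 0)
  have hPi : Integrable (fun z : Circle => poissonKernel 0 (γ.1 0 : 𝔻) z) m := by
    have := integrable_of_continuous (μ := m) (Complex.continuous_ofReal.comp hP)
    exact (Complex.reCLM.integrable_comp this)
  have : IsFiniteMeasure
      (m.withDensity fun z => ENNReal.ofReal (poissonKernel 0 (γ.1 0 : 𝔻) z)) :=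
    isFiniteMeasure_withDensity_ofReal hPi.2
  refine measure_ext_of_fourier fun n => ?_
  rw [integral_map hb.aemeasurable (Continuous.aestronglyMeasurable (by fun_prop))]
  have h1 : DiffContOnCl ℂ (fun z => (unimod γ * blaschke (γ.1.symm 0 : 𝔻) z) ^ n)
      (Metric.ball 0 1) :=
    diffContOnCl_pow ((diffContOnCl_blaschke (UnitDisc.norm_lt_one _)).const_smul (unimod γ : ℂ)) n
  have h2 := integral_m_of_diffContOnCl h1
  simp only [coe_bdry]
  rw [h2, integral_withDensity_eq_integral_toReal_smul hP.measurable.ennreal_ofReal (by simp)]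
  have h3 : DiffContOnCl ℂ (fun z : ℂ => z ^ n) (Metric.ball 0 1) :=
    (differentiable_id.pow n).diffContOnCl
  have h4 := h3.circleAverage_poissonKernel_smul (w := (γ.1 0 : 𝔻)) (by simp [UnitDisc.norm_lt_one])
  rw [← integral_m_eq_circleAverage] at h4
  · simp only [ENNReal.toReal_ofReal (poissonKernel_nonneg _ _)]
    simp only [Pi.smul_apply'] at h4
    rw [h4, coe_apply_zero]
    simp [blaschke]
  · refine ContinuousOn.smul ?_ (by fun_prop)
    unfold poissonKernel
    refine ContinuousOn.div (by fun_prop) (by fun_prop) fun z hz => pow_ne_zero 2 ?_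
    have hw := (γ.1 0).norm_lt_one
    rw [mem_sphere_zero_iff_norm] at hz
    rw [norm_ne_zero_iff, sub_zero, sub_zero, sub_ne_zero]
    rintro rfl
    exact hw.ne hz

theorem integral_comp_bdry (γ : diskAut) {f : Circle → ℂ} (hf : AEStronglyMeasurable f m) :
    ∫ z, f (bdry γ z) ∂m =
      ∫ z, (szego (γ.1 0) z + conj (szego (γ.1 0) z) - 1) * f z ∂m := by
  have hb := quasiMeasurePreserving_bdry γ
  rw [← integral_map (μ := m) hb.measurable.aemeasurable (hf.mono_ac hb.absolutelyContinuous),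
    map_bdry, integral_withDensity_eq_integral_toReal_smul
      (continuous_poissonKernel _).measurable.ennreal_ofReal (by simp)]
  simp only [ENNReal.toReal_ofReal (poissonKernel_nonneg _ _), szego_add_conj, real_smul]

/-- The pushforward of `m` has bounded density, so it is dominated by a multiple of `m`. -/
theorem memLp_comp_bdry (γ : diskAut) {p : ℝ≥0∞} {f : Circle → ℂ} (hf : MemLp f p m) :
    MemLp (fun z => f (bdry γ z)) p m := by
  have hb := quasiMeasurePreserving_bdry γ
  obtain ⟨C, hC⟩ := isCompact_univ.exists_bound_of_continuousOn
    (continuous_poissonKernel (γ.1 0)).continuousOn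
  have hle : m.map (bdry γ) ≤ ENNReal.ofReal C • m := by
    rw [map_bdry, ← withDensity_const]
    refine withDensity_mono (ae_of_all _ fun z => ENNReal.ofReal_le_ofReal ?_)
    exact (Real.le_norm_self _).trans (hC z (Set.mem_univ z))
  exact (hf.of_measure_le_smul ENNReal.ofReal_ne_top hle).comp_of_map hb.measurable.aemeasurable

/-- The inverse of an automorphism is a multiple of the Blaschke factor of its value at `0`. -/
theorem blaschke_bdry (γ : diskAut) (z : Circle) :
    (unimod γ : ℂ)⁻¹ * blaschke (γ.1 0 : 𝔻) (bdry γ z) = z := by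
  have hl : (unimod γ : ℂ) ≠ 0 := Circle.coe_ne_zero _
  have hll : conj (unimod γ : ℂ) * unimod γ = 1 := by
    rw [← Circle.coe_inv_eq_conj, Circle.coe_inv, inv_mul_cancel₀ hl]
  have h := blaschke_blaschke (UnitDisc.norm_lt_one (γ.1.symm 0)) (Circle.norm_coe z).le
  rw [coe_bdry, coe_apply_zero]
  refine Eq.trans ?_ h
  set u := blaschke (γ.1.symm 0 : 𝔻) z
  have h2 : conj ((unimod γ : ℂ) * ((γ.1.symm 0 : 𝔻) : ℂ)) * (unimod γ * u) =
      conj ((γ.1.symm 0 : 𝔻) : ℂ) * u := by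
    rw [map_mul]
    linear_combination (conj ((γ.1.symm 0 : 𝔻) : ℂ) * u) * hll
  rw [blaschke, blaschke, h2, ← mul_sub, mul_div_assoc, inv_mul_cancel_left₀ hl]

/-- Composition with automorphisms preserves the Hardy spaces. -/
theorem integral_monomial_comp_bdry {p : ℝ≥0∞} [Fact (1 ≤ p)] (γ : diskAut) {f : Lp ℂ p m}
    (hf : f ∈ Hp p) {n : ℤ} (hn : n < 0) :
    ∫ z, ((z ^ (-n) : Circle) : ℂ) * f (bdry γ z) ∂m = 0 := by
  -- The exponent is at least `1`: one Blaschke factor is set aside to cancel the pole of the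
  -- Poisson kernel at `w`.
  obtain ⟨k, hk⟩ : ∃ k : ℕ, -n = ((k + 1 : ℕ) : ℤ) := ⟨(-n - 1).toNat, by omega⟩
  set w : 𝔻 := γ.1 0 with hw
  set l : ℂ := (unimod γ : ℂ)⁻¹
  have hb : DiffContOnCl ℂ (fun z => l * blaschke w z) (Metric.ball 0 1) :=
    (diffContOnCl_blaschke w.norm_lt_one).const_smul l
  have h1 : ∀ z : Circle, ((z ^ (-n) : Circle) : ℂ) * f (bdry γ z) =
      (fun u : Circle => (l * blaschke w u) ^ (k + 1) * f u) (bdry γ z) := fun z => by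
    rw [hk, zpow_natCast, Circle.coe_pow]
    simp only [l, w, blaschke_bdry]
  refine (integral_congr_ae (ae_of_all _ h1)).trans ((integral_comp_bdry γ
    (f := fun u : Circle => (l * blaschke w u) ^ (k + 1) * f u) ?_).trans ?_)
  · have := continuous_of_diffContOnCl (diffContOnCl_pow hb (k + 1))
    exact this.aestronglyMeasurable.mul (Lp.aestronglyMeasurable f)
  -- Poisson kernel times one factor `l * blaschke w z` equals `-l (1 - |w|²) z / (1 - conj w z)²`,
  -- which is holomorphic in the disc and vanishes at `0`. The other `k` factors are harmless.
  · let F : ℂ → ℂ := fun z => (l * blaschke w z) ^ k *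
      (-(l * (1 - conj (w : ℂ) * w)) * (z / (1 - conj (w : ℂ) * z) ^ 2))
    have hd : DiffContOnCl ℂ (fun z : ℂ => z / (1 - conj (w : ℂ) * z) ^ 2) (Metric.ball 0 1) := by
      constructor
      · exact DifferentiableOn.div (by fun_prop) (by fun_prop) fun z hz =>
          pow_ne_zero 2 (one_sub_ne_zero w.norm_lt_one (mem_ball_zero_iff.1 hz).le)
      · rw [closure_ball _ one_ne_zero]
        exact ContinuousOn.div (by fun_prop) (by fun_prop) fun z hz =>
          pow_ne_zero 2 (one_sub_ne_zero w.norm_lt_one (mem_closedBall_zero_iff.1 hz))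
    have hF : DiffContOnCl ℂ F (Metric.ball 0 1) :=
      (diffContOnCl_pow hb k).smul (hd.const_smul (-(l * (1 - conj (w : ℂ) * w))))
    rw [← integral_diffContOnCl_mul_eq_zero hF (by simp [F]) hf]
    congr 1
    ext z
    have h2 := sub_ne_zero_of_norm (w := w) z
    have h3 := one_sub_ne_zero w.norm_lt_one (Circle.norm_coe z).le
    simp only [F]
    rw [conj_szego, szego, pow_succ, ← hw]
    have h4 : (1 / (1 - conj (w : ℂ) * z) + z / (z - w) - 1) * (l * blaschke w z) =
        -(l * (1 - conj (w : ℂ) * w)) * (z / (1 - conj (w : ℂ) * z) ^ 2) := by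
      rw [blaschke]
      field_simp
      ring
    rw [← h4]
    ring

end FuchsianHardy
end

noncomputable section

/-! ### Duality of Lebesgue spaces over a finite measure space -/

namespace MeasureTheory

open Filter Topology

section ConjSign

variable {Ω : Type*}

/-- The function `conj (g x) / ‖g x‖`. -/
def conjSign (g : Ω → ℂ) (x : Ω) : ℂ := conj (g x) / ‖g x‖

theorem conjSign_mul (g : Ω → ℂ) (x : Ω) : conjSign g x * g x = ‖g x‖ := by
  rcases eq_or_ne (g x) 0 with h | h
  · simp [h]
  · have : (‖g x‖ : ℂ) ≠ 0 := by simpa using h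
    rw [conjSign, div_mul_eq_mul_div, div_eq_iff this, Complex.conj_mul', sq]

theorem norm_conjSign_le (g : Ω → ℂ) (x : Ω) : ‖conjSign g x‖ ≤ 1 := by
  rw [conjSign, norm_div, RCLike.norm_conj]
  simpa using div_self_le_one _

theorem norm_conjSign {g : Ω → ℂ} {x : Ω} (h : g x ≠ 0) : ‖conjSign g x‖ = 1 := by
  rw [conjSign, norm_div, RCLike.norm_conj]
  simpa using h

theorem measurable_conjSign [MeasurableSpace Ω] {g : Ω → ℂ} (hg : Measurable g) : Measurable (conjSign g) := by
  unfold conjSign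
  exact (Complex.continuous_conj.measurable.comp hg).div
    (Complex.measurable_ofReal.comp hg.norm)

end ConjSign

variable {Ω : Type*} [MeasurableSpace Ω] {μ : Measure Ω} [IsFiniteMeasure μ]

/-- Testing on `conjSign g` over the set `E` where `C < ‖g‖` gives `∫_E ‖g‖ ≤ C μ(E)`, which forces
`E` to be null. -/
theorem ae_norm_le_of_forall_bounded {g : Ω → ℂ} (hgm : Measurable g) (hg : Integrable g μ)
    {C : ℝ} (h : ∀ f : Ω → ℂ, Measurable f → (∃ K, ∀ x, ‖f x‖ ≤ K) →
      ‖∫ x, f x * g x ∂μ‖ ≤ C * (eLpNorm f 1 μ).toReal) (hC : 0 ≤ C) :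
    ∀ᵐ x ∂μ, ‖g x‖ ≤ C := by
  set E : Set Ω := {x | C < ‖g x‖} with hE
  have hEm : MeasurableSet E := measurableSet_lt measurable_const hgm.norm
  have h1 := h (E.indicator (conjSign g)) ((measurable_conjSign hgm).indicator hEm)
    ⟨1, fun x => (norm_indicator_le_norm_self _ _).trans (norm_conjSign_le g x)⟩
  have h2 : ∫ x, E.indicator (conjSign g) x * g x ∂μ = ((∫ x in E, ‖g x‖ ∂μ : ℝ) : ℂ) := by
    rw [← integral_complex_ofReal, ← integral_indicator hEm]
    congr 1
    ext x
    by_cases hx : x ∈ E <;> simp [hx, conjSign_mul]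
  have h3 : (eLpNorm (E.indicator (conjSign g)) 1 μ).toReal ≤ μ.real E := by
    refine ENNReal.toReal_mono (measure_ne_top μ E) ?_
    rw [eLpNorm_indicator_eq_eLpNorm_restrict hEm]
    refine (eLpNorm_le_of_ae_bound (C := 1) (ae_of_all _ (norm_conjSign_le g))).trans ?_
    simp
  rw [h2, Complex.norm_real, Real.norm_of_nonneg (integral_nonneg fun x => norm_nonneg _)] at h1
  have h4 : ∫ x in E, (‖g x‖ - C) ∂μ ≤ 0 := by
    rw [integral_sub hg.norm.integrableOn (integrable_const C)]
    simp only [integral_const, smul_eq_mul, measureReal_restrict_apply_univ]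
    nlinarith
  have h5 : ∀ᵐ x ∂μ.restrict E, C < ‖g x‖ := ae_restrict_mem hEm
  have h6 : 0 ≤ᵐ[μ.restrict E] fun x => ‖g x‖ - C := by
    filter_upwards [h5] with x hx
    exact sub_nonneg.2 hx.le
  have h7 := (integral_eq_zero_iff_of_nonneg_ae h6
    (hg.norm.integrableOn.sub (integrable_const C))).1 (le_antisymm h4 (integral_nonneg_of_ae h6))
  have h8 : ∀ᵐ x ∂μ.restrict E, False := by
    filter_upwards [h5, h7] with x hx hx'
    simp only [Pi.zero_apply] at hx'
    linarith
  rw [ae_restrict_iff' hEm] at h8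
  filter_upwards [h8] with x hx
  exact not_lt.1 fun hlt => hx hlt

/-- With `G = g 1_E`, the extremal test function `f = conjSign G * ‖G‖ ^ (s - 1)` satisfies `f g =
‖G‖ ^ s = ‖f‖ ^ r`, so `A = ∫ ‖G‖ ^ s` obeys `A ≤ C A ^ (1/r)`. The truncation keeps `f` bounded and
`A` finite, which permits the division. -/
theorem eLpNorm_le_of_forall_bounded_of_bounded {g : Ω → ℂ} (hgm : Measurable g)
    {p q : ℝ≥0∞} [hpq : ENNReal.HolderConjugate p q] (hp : p ≠ ∞) (hq : q ≠ ∞) {C : ℝ}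
    {E : Set Ω} (hE : MeasurableSet E) {K : ℝ} (hK : 0 ≤ K) (hgK : ∀ x ∈ E, ‖g x‖ ≤ K)
    (h : ∀ f : Ω → ℂ, Measurable f → (∃ K, ∀ x, ‖f x‖ ≤ K) →
      ‖∫ x, f x * g x ∂μ‖ ≤ C * (eLpNorm f p μ).toReal) (hC : 0 ≤ C) :
    eLpNorm (E.indicator g) q μ ≤ ENNReal.ofReal C := by
  have hp0 : p ≠ 0 := hpq.ne_zero
  have hq0 : q ≠ 0 := hpq.symm.ne_zero
  have hr : p.toReal.HolderConjugate q.toReal := by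
    refine ENNReal.HolderConjugate.toReal ?_
    have h1 : 1 < p := (ENNReal.HolderConjugate.lt_top_iff_one_lt q p).1 hq.lt_top
    rwa [← ENNReal.toReal_one, ENNReal.toReal_lt_toReal ENNReal.one_ne_top hp]
  set s := q.toReal with hs
  set r := p.toReal with hr'
  have hs1 : 0 < s - 1 := by linarith [hr.symm.lt]
  set G := E.indicator g with hG
  have hGm : Measurable G := hgm.indicator hE
  have hGK : ∀ x, ‖G x‖ ≤ K := fun x => by
    by_cases hx : x ∈ E <;> simp [hG, hx, hgK, hK]
  set f : Ω → ℂ := fun x => conjSign G x * ((‖G x‖ ^ (s - 1) : ℝ) : ℂ) with hf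
  have hfm : Measurable f := (measurable_conjSign hGm).mul
    (Complex.measurable_ofReal.comp (hGm.norm.pow_const _))
  have hfn : ∀ x, ‖f x‖ = ‖G x‖ ^ (s - 1) := fun x => by
    have h0 : 0 ≤ ‖G x‖ ^ (s - 1) := Real.rpow_nonneg (norm_nonneg _) _
    rw [hf, norm_mul, Complex.norm_real, Real.norm_of_nonneg h0]
    rcases eq_or_ne (G x) 0 with hx | hx
    · rw [hx, norm_zero, Real.zero_rpow hs1.ne', mul_zero]
    · rw [norm_conjSign hx, one_mul]
  have hfK : ∀ x, ‖f x‖ ≤ K ^ (s - 1) := fun x => by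
    rw [hfn]
    exact Real.rpow_le_rpow (norm_nonneg _) (hGK x) hs1.le
  have hfg : ∀ x, f x * g x = ((‖G x‖ ^ s : ℝ) : ℂ) := fun x => by
    by_cases hx : x ∈ E
    · have hgx : g x = G x := by simp [hG, hx]
      rw [hgx, hf, mul_right_comm, conjSign_mul, ← Complex.ofReal_mul]
      congr 1
      rcases eq_or_ne (‖G x‖) 0 with hx | hx
      · rw [hx, zero_mul, Real.zero_rpow hr.symm.pos.ne']
      · rw [mul_comm, ← Real.rpow_add_one hx, sub_add_cancel]
    · have : G x = 0 := by simp [hG, hx]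
      simp [hf, this, conjSign, Real.zero_rpow hr.symm.pos.ne']
  have hfr : ∀ x, ‖f x‖ ^ r = ‖G x‖ ^ s := fun x => by
    rw [hfn, ← Real.rpow_mul (norm_nonneg _), hr.symm.sub_one_mul_conj]
  have h1 := h f hfm ⟨_, hfK⟩
  have hfp : MemLp f p μ := .of_bound hfm.aestronglyMeasurable _ (ae_of_all _ hfK)
  have hGq : MemLp G q μ := .of_bound hGm.aestronglyMeasurable _ (ae_of_all _ hGK)
  simp_rw [hfg] at h1
  rw [integral_complex_ofReal, Complex.norm_real, hfp.eLpNorm_eq_integral_rpow_norm hp0 hp] at h1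
  simp_rw [← hr', hfr] at h1
  rw [hGq.eLpNorm_eq_integral_rpow_norm hq0 hq, ← hs]
  set A := ∫ x, ‖G x‖ ^ s ∂μ
  have hA : 0 ≤ A := integral_nonneg fun x => Real.rpow_nonneg (norm_nonneg _) _
  rw [Real.norm_of_nonneg hA, ENNReal.toReal_ofReal (Real.rpow_nonneg hA _)] at h1
  refine ENNReal.ofReal_le_ofReal ?_
  rcases hA.eq_or_lt with hA0 | hA0
  · rw [← hA0, Real.zero_rpow (inv_ne_zero hr.symm.pos.ne')]
    exact hC
  · have h2 : A = A ^ s⁻¹ * A ^ r⁻¹ := by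
      rw [← Real.rpow_add hA0, add_comm, hr.inv_add_inv_eq_one, Real.rpow_one]
    nth_rewrite 1 [h2] at h1
    exact le_of_mul_le_mul_right h1 (Real.rpow_pos_of_pos hA0 _)

/-- The converse of Hölder's inequality. -/
theorem eLpNorm_le_of_forall_bounded {g : Ω → ℂ} (hg : Integrable g μ)
    {p q : ℝ≥0∞} [hpq : ENNReal.HolderConjugate p q] (hp : p ≠ ∞) {C : ℝ} (hC : 0 ≤ C)
    (h : ∀ f : Ω → ℂ, Measurable f → (∃ K, ∀ x, ‖f x‖ ≤ K) →
      ‖∫ x, f x * g x ∂μ‖ ≤ C * (eLpNorm f p μ).toReal) :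
    eLpNorm g q μ ≤ ENNReal.ofReal C := by
  wlog hgm : Measurable g generalizing g
  · have hae := hg.1.ae_eq_mk
    rw [eLpNorm_congr_ae hae]
    refine this (hg.congr hae) (fun f hf hK => ?_) hg.1.stronglyMeasurable_mk.measurable
    rw [← integral_congr_ae (f := fun x => f x * g x)]
    · exact h f hf hK
    · filter_upwards [hae] with x hx
      rw [hx]
  by_cases hq : q = ∞
  · have hp1 : p = 1 := by
      have := hpq.inv_add_inv_eq_inv
      simpa [hq] using this
    subst hp1
    subst hq
    rw [eLpNorm_exponent_top]
    refine eLpNormEssSup_le_of_ae_bound (ae_norm_le_of_forall_bounded hgm hg h hC)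
  -- The truncations of `g` to `‖g‖ ≤ n` obey a uniform bound, which Fatou's lemma passes to `g`.
  · let E : ℕ → Set Ω := fun n => {x | ‖g x‖ ≤ n}
    have hE : ∀ n, MeasurableSet (E n) := fun n => measurableSet_le hgm.norm measurable_const
    refine (Lp.eLpNorm_lim_le_liminf_eLpNorm (f := fun n => (E n).indicator g)
      (fun n => (hgm.indicator (hE n)).aestronglyMeasurable) g (ae_of_all _ fun x => ?_)).trans ?_
    · refine tendsto_const_nhds.congr' ?_
      filter_upwards [eventually_ge_atTop ⌈‖g x‖⌉₊] with n hn
      have : x ∈ E n := show ‖g x‖ ≤ n from (Nat.le_ceil _).trans (by exact_mod_cast hn)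
      simp [this]
    · refine liminf_le_of_le (by isBoundedDefault) fun b hb => ?_
      obtain ⟨n, hn⟩ := hb.exists
      exact hn.trans (eLpNorm_le_of_forall_bounded_of_bounded hgm hp hq (hE n) n.cast_nonneg
        (fun x hx => hx) h hC)

/-- The complex measure `E ↦ φ 1_E` of a functional on a Lebesgue space. -/
def functionalMeasure {p : ℝ≥0∞} [Fact (1 ≤ p)] (hp : p ≠ ∞) (φ : StrongDual ℂ (Lp ℂ p μ)) :
    ComplexMeasure Ω where
  measureOf' E := by
    classical
    exact if hE : MeasurableSet E then φ (indicatorConstLp p hE (measure_ne_top μ E) 1) else 0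
  empty' := by simp
  not_measurable' E hE := by simp [hE]
  m_iUnion' E hE hd := by
    have hU : MeasurableSet (⋃ i, E i) := .iUnion hE
    have hF : ∀ F : Finset ℕ, MeasurableSet (⋃ i ∈ F, E i) := fun F =>
      F.measurableSet_biUnion fun i _ => hE i
    simp only [hE, hU, dif_pos]
    have h1 : ∀ F : Finset ℕ, ∑ i ∈ F, φ (indicatorConstLp p (hE i) (measure_ne_top μ _) 1) =
        φ (indicatorConstLp p (hF F) (measure_ne_top μ _) 1) := fun F => by
      rw [← map_sum]
      congr 1
      induction F using Finset.induction_on with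
      | empty => simp
      | insert a F ha ih =>
        rw [Finset.sum_insert ha, ih, ← indicatorConstLp_disjoint_union]
        · congr 1
          simp
        · simp only [Set.disjoint_iUnion_right]
          intro i hi
          exact hd (by rintro rfl; exact ha hi)
    unfold HasSum
    simp only [h1, SummationFilter.unconditional_filter]
    -- Countable additivity: the remaining tails have measure tending to zero, and for `p < ∞` this
    -- gives convergence of the indicators in `L^p`.
    refine (φ.continuous.tendsto _).comp (tendsto_indicatorConstLp_set hp ?_)
    have h2 : Tendsto (fun F : Finset ℕ => μ (⋃ i ∈ F, E i)) atTop (𝓝 (μ (⋃ i, E i))) := by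
      have := tendsto_measure_iUnion_atTop (μ := μ) (s := fun F : Finset ℕ => ⋃ i ∈ F, E i)
        fun F F' hFF' => Set.biUnion_mono hFF' fun _ _ => le_rfl
      rwa [← Set.iUnion_eq_iUnion_finset] at this
    have h3 := ENNReal.Tendsto.sub (tendsto_const_nhds (x := μ (⋃ i, E i))) h2
      (Or.inl (measure_ne_top μ _))
    rw [tsub_self] at h3
    refine h3.congr fun F => ?_
    have hsub : (⋃ i ∈ F, E i) ⊆ ⋃ i, E i := Set.iUnion₂_subset_iUnion _ _
    rw [symmDiff_of_le hsub, measure_sdiff hsub (hF F).nullMeasurableSet (measure_ne_top μ _)]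

theorem functionalMeasure_apply {p : ℝ≥0∞} [Fact (1 ≤ p)] (hp : p ≠ ∞)
    (φ : StrongDual ℂ (Lp ℂ p μ)) {E : Set Ω} (hE : MeasurableSet E) :
    functionalMeasure hp φ E = φ (indicatorConstLp p hE (measure_ne_top μ E) 1) :=
  dif_pos hE

/-- `g` is the Radon-Nikodym derivative of `functionalMeasure`, which is absolutely continuous since
indicators of null sets are zero in `L^p`. At this stage `g` is only known to be integrable. -/
theorem exists_integrable_forall_indicator {p : ℝ≥0∞} [Fact (1 ≤ p)] (hp : p ≠ ∞)
    (φ : StrongDual ℂ (Lp ℂ p μ)) : ∃ g : Ω → ℂ, Integrable g μ ∧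
      ∀ {E : Set Ω} (hE : MeasurableSet E),
        φ (indicatorConstLp p hE (measure_ne_top μ E) 1) = ∫ x in E, g x ∂μ := by
  set ν := functionalMeasure hp φ with hν
  have hac : ν ≪ᵥ μ.toENNRealVectorMeasure := by
    refine VectorMeasure.AbsolutelyContinuous.mk fun E hE h0 => ?_
    rw [Measure.toENNRealVectorMeasure_apply_measurable hE] at h0
    rw [hν, functionalMeasure_apply hp φ hE]
    have : indicatorConstLp p hE (measure_ne_top μ E) (1 : ℂ) = 0 := by
      rw [Lp.eq_zero_iff_ae_eq_zero]
      exact indicatorConstLp_coeFn.trans (indicator_meas_zero h0)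
    rw [this, map_zero]
  obtain ⟨hre, him⟩ := (ComplexMeasure.absolutelyContinuous_ennreal_iff _ _).1 hac
  have hre' := SignedMeasure.withDensityᵥ_rnDeriv_eq _ μ hre
  have him' := SignedMeasure.withDensityᵥ_rnDeriv_eq _ μ him
  refine ⟨ν.rnDeriv μ, ComplexMeasure.integrable_rnDeriv ν μ, fun {E} hE => ?_⟩
  rw [← functionalMeasure_apply hp φ hE, ← hν]
  have hi := (ComplexMeasure.integrable_rnDeriv ν μ).integrableOn (s := E)
  apply Complex.ext
  · change ComplexMeasure.re ν E = _
    rw [← hre', withDensityᵥ_apply (SignedMeasure.integrable_rnDeriv _ _) hE]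
    exact (integral_re hi : _)
  · change ComplexMeasure.im ν E = _
    rw [← him', withDensityᵥ_apply (SignedMeasure.integrable_rnDeriv _ _) hE]
    exact (integral_im hi : _)

end MeasureTheory
end

/-! ### The bilinear pairing and the Riesz representation of functionals on `L^p` -/

noncomputable section

namespace MeasureTheory

open Filter Topology

variable {Ω : Type*} [MeasurableSpace Ω] {μ : Measure Ω}

/-- The bilinear pairing of conjugate Lebesgue spaces. -/
def Lp.pairing (p q : ℝ≥0∞) [Fact (1 ≤ p)] [Fact (1 ≤ q)] [ENNReal.HolderConjugate p q] :
    Lp ℂ p μ →L[ℂ] Lp ℂ q μ →L[ℂ] ℂ :=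
  (ContinuousLinearMap.mul ℂ ℂ).lpPairing μ p q

theorem Lp.pairing_apply {p q : ℝ≥0∞} [Fact (1 ≤ p)] [Fact (1 ≤ q)]
    [ENNReal.HolderConjugate p q] (f : Lp ℂ p μ) (g : Lp ℂ q μ) :
    Lp.pairing p q f g = ∫ x, f x * g x ∂μ := by
  simp [Lp.pairing, ContinuousLinearMap.lpPairing_eq_integral]

theorem Lp.norm_pairing_le {p q : ℝ≥0∞} [Fact (1 ≤ p)] [Fact (1 ≤ q)]
    [ENNReal.HolderConjugate p q] (f : Lp ℂ p μ) (g : Lp ℂ q μ) :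
    ‖∫ x, f x * g x ∂μ‖ ≤ ‖f‖ * ‖g‖ := by
  have h1 := ((ContinuousLinearMap.mul ℂ ℂ).norm_holder_apply_apply_le (r := 1) f g)
  have h2 : ∫ x, f x * g x ∂μ = ∫ x, (ContinuousLinearMap.mul ℂ ℂ).holder 1 f g x ∂μ := by
    refine integral_congr_ae ?_
    filter_upwards [(ContinuousLinearMap.mul ℂ ℂ).coeFn_holder (r := 1) f g] with x hx
    rw [hx]
    rfl
  rw [h2]
  refine (norm_integral_le_integral_norm _).trans ?_
  rw [← L1.norm_eq_integral_norm]
  refine h1.trans ?_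
  refine (mul_le_mul_of_nonneg_right (mul_le_mul_of_nonneg_right
    (ContinuousLinearMap.opNorm_mul_le ℂ ℂ) (norm_nonneg _)) (norm_nonneg _)).trans ?_
  rw [one_mul]

variable [IsFiniteMeasure μ]

theorem functional_simpleFunc_eq_integral {p : ℝ≥0∞} [Fact (1 ≤ p)]
    (φ : StrongDual ℂ (Lp ℂ p μ)) {g : Ω → ℂ} (hg : Integrable g μ)
    (h : ∀ {E : Set Ω} (hE : MeasurableSet E),
      φ (indicatorConstLp p hE (measure_ne_top μ E) 1) = ∫ x in E, g x ∂μ)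
    (f : SimpleFunc Ω ℂ) (hf : MemLp f p μ) : φ (hf.toLp f) = ∫ x, f x * g x ∂μ := by
  induction f using SimpleFunc.induction with
  | const c hE =>
    rename_i E
    have h1 : hf.toLp _ = c • indicatorConstLp p hE (measure_ne_top μ E) (1 : ℂ) := by
      rw [indicatorConstLp, ← MemLp.toLp_const_smul]
      refine MemLp.toLp_congr _ _ (ae_of_all _ fun x => ?_)
      by_cases hx : x ∈ E <;> simp [hx]
    rw [h1, map_smul, h hE, ← integral_indicator hE, smul_eq_mul, ← integral_const_mul]
    congr 1
    ext x
    by_cases hx : x ∈ E <;> simp [hx]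
  | add _ h₁ h₂ =>
    rename_i f₁ f₂ _
    have m₁ : MemLp f₁ p μ := f₁.memLp_of_isFiniteMeasure p μ
    have m₂ : MemLp f₂ p μ := f₂.memLp_of_isFiniteMeasure p μ
    have hi : ∀ f : SimpleFunc Ω ℂ, Integrable (fun x => f x * g x) μ := fun f => by
      obtain ⟨C, hC⟩ := f.exists_forall_norm_le
      exact hg.bdd_mul f.aestronglyMeasurable (ae_of_all _ hC)
    have h3 : hf.toLp _ = m₁.toLp f₁ + m₂.toLp f₂ := by
      rw [← MemLp.toLp_add]
      rfl
    rw [h3, map_add, h₁ m₁, h₂ m₂, ← integral_add (hi f₁) (hi f₂)]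
    simp [add_mul]

/-- Bounded functions are the largest class for which `f * g` is visibly integrable before `g` is
known to lie in `L^q`. They suffice for the converse of Hölder's inequality, which then places `g`
there. -/
theorem functional_bounded_eq_integral {p : ℝ≥0∞} [Fact (1 ≤ p)] (hp : p ≠ ∞)
    (φ : StrongDual ℂ (Lp ℂ p μ)) {g : Ω → ℂ} (hg : Integrable g μ)
    (h : ∀ {E : Set Ω} (hE : MeasurableSet E),
      φ (indicatorConstLp p hE (measure_ne_top μ E) 1) = ∫ x in E, g x ∂μ)
    {f : Ω → ℂ} (hfm : Measurable f) {K : ℝ} (hK : ∀ x, ‖f x‖ ≤ K) (hf : MemLp f p μ) :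
    φ (hf.toLp f) = ∫ x, f x * g x ∂μ := by
  let s : ℕ → SimpleFunc Ω ℂ := fun n =>
    SimpleFunc.approxOn f hfm (Set.range f ∪ {0}) 0 (by simp) n
  have hs : ∀ n, MemLp (s n) p μ := fun n => (s n).memLp_of_isFiniteMeasure p μ
  have h1 : Tendsto (fun n => φ ((hs n).toLp (s n))) atTop (𝓝 (φ (hf.toLp f))) := by
    refine (φ.continuous.tendsto _).comp ((Lp.tendsto_Lp_iff_tendsto_eLpNorm'' _ hs f hf).2 ?_)
    exact SimpleFunc.tendsto_approxOn_range_Lp_eLpNorm hp hfm hf.2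
  have h2 : Tendsto (fun n => ∫ x, s n x * g x ∂μ) atTop (𝓝 (∫ x, f x * g x ∂μ)) := by
    refine tendsto_integral_of_dominated_convergence (fun x => (K + K) * ‖g x‖)
      (fun n => (s n).aestronglyMeasurable.mul hg.1) (hg.norm.const_mul _)
      (fun n => ae_of_all _ fun x => ?_) (ae_of_all _ fun x => ?_)
    · rw [norm_mul]
      gcongr
      exact (SimpleFunc.norm_approxOn_zero_le hfm (by simp) x n).trans (add_le_add (hK x) (hK x))
    · refine Tendsto.mul_const _ (SimpleFunc.tendsto_approxOn hfm _ (subset_closure ?_))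
      simp
  refine tendsto_nhds_unique h1 (h2.congr fun n => ?_)
  exact (functional_simpleFunc_eq_integral φ hg h (s n) (hs n)).symm

theorem Lp.norm_le_of_forall_pairing_le {p q : ℝ≥0∞} [Fact (1 ≤ p)] [Fact (1 ≤ q)]
    [ENNReal.HolderConjugate p q] (hp : p ≠ ∞) {g : Lp ℂ q μ} {C : ℝ} (hC : 0 ≤ C)
    (h : ∀ f : Lp ℂ p μ, ‖∫ x, f x * g x ∂μ‖ ≤ C * ‖f‖) : ‖g‖ ≤ C := by
  rw [Lp.norm_def]
  refine ENNReal.toReal_le_of_le_ofReal hC ?_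
  refine eLpNorm_le_of_forall_bounded ((Lp.memLp g).integrable Fact.out) hp hC
    fun f hfm ⟨K, hK⟩ => ?_
  have hf : MemLp f p μ := .of_bound hfm.aestronglyMeasurable _ (ae_of_all _ hK)
  have h1 := h (hf.toLp f)
  rw [Lp.norm_toLp] at h1
  refine le_of_eq_of_le ?_ h1
  congr 1
  refine integral_congr_ae ?_
  filter_upwards [hf.coeFn_toLp] with x hx
  rw [hx]

/-- Every functional on `L^p`, `1 ≤ p < ∞`, is integration against a function of `L^q`. -/
theorem Lp.exists_eq_integral {p q : ℝ≥0∞} [Fact (1 ≤ p)] [Fact (1 ≤ q)]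
    [ENNReal.HolderConjugate p q] (hp : p ≠ ∞) (φ : StrongDual ℂ (Lp ℂ p μ)) :
    ∃ g : Lp ℂ q μ, ∀ f : Lp ℂ p μ, φ f = ∫ x, f x * g x ∂μ := by
  obtain ⟨g, hg, h⟩ := exists_integrable_forall_indicator hp φ
  have hgq : eLpNorm g q μ ≤ ENNReal.ofReal ‖φ‖ := by
    refine eLpNorm_le_of_forall_bounded hg hp (norm_nonneg _) fun f hfm ⟨K, hK⟩ => ?_
    have hf : MemLp f p μ := .of_bound hfm.aestronglyMeasurable _ (ae_of_all _ hK)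
    rw [← functional_bounded_eq_integral hp φ hg h hfm hK hf, ← Lp.norm_toLp f hf]
    exact φ.le_opNorm _
  have hgm : MemLp g q μ := ⟨hg.1, hgq.trans_lt ENNReal.ofReal_lt_top⟩
  refine ⟨hgm.toLp g, fun f => ?_⟩
  rw [← Lp.pairing_apply]
  -- Now that `g` is in `L^q`, both sides are continuous on `L^p`, and agreement on indicators is
  -- enough.
  suffices hφ : φ = (Lp.pairing p q).flip (hgm.toLp g) by
    rw [hφ]
    rfl
  ext f
  induction f using Lp.induction hp with
  | indicatorConst c hs hμs =>
    rename_i s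
    rw [Lp.simpleFunc.coe_indicatorConst]
    have h1 : indicatorConstLp p hs hμs.ne c =
        c • indicatorConstLp p hs (measure_ne_top μ s) (1 : ℂ) := by
      rw [indicatorConstLp, indicatorConstLp, ← MemLp.toLp_const_smul]
      refine MemLp.toLp_congr _ _ (ae_of_all _ fun x => ?_)
      by_cases hx : x ∈ s <;> simp [hx]
    rw [h1, map_smul, map_smul, h hs, ContinuousLinearMap.flip_apply, Lp.pairing_apply,
      ← integral_indicator hs]
    congr 1
    refine integral_congr_ae ?_
    filter_upwards [hgm.coeFn_toLp, indicatorConstLp_coeFn (p := p) (hs := hs)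
      (hμs := measure_ne_top μ s) (c := (1 : ℂ))] with x hx hx'
    rw [hx, hx']
    by_cases hxs : x ∈ s <;> simp [hxs]
  | add hf hg _ h₁ h₂ => rw [map_add, map_add, h₁, h₂]
  | isClosed => exact isClosed_eq φ.continuous (ContinuousLinearMap.continuous _)

end MeasureTheory
end

noncomputable section

namespace FuchsianHardy

/-! ### Invariant functions and the conditional expectation -/

theorem invSigma_le (Γ : Subgroup diskAut) : invSigma Γ ≤ (inferInstance : MeasurableSpace Circle) :=
  fun _ h => h.1

theorem measurable_invSigma_of_comp {Γ : Subgroup diskAut} {f : Circle → ℂ} (hf : Measurable f)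
    (h : ∀ γ ∈ Γ, (fun z => f (bdry γ z)) =ᵐ[m] f) : Measurable[invSigma Γ] f := by
  intro B hB
  refine ⟨hf hB, fun γ hγ => ?_⟩
  rw [measure_symmDiff_eq_zero_iff]
  filter_upwards [h γ hγ] with z hz
  change (f z ∈ B) = (f (bdry γ z) ∈ B)
  rw [hz]

/-- Outside one null set, `f z` and `f (γ z)` belong to the same members of a countable base, hence
coincide. With `measurable_invSigma_of_comp` this identifies `L^p_Γ` with the functions measurable
for `invSigma Γ`, the range of `Ψ`. -/
theorem comp_ae_eq_of_measurable_invSigma {Γ : Subgroup diskAut} {f : Circle → ℂ}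
    (hf : Measurable[invSigma Γ] f) {γ : diskAut} (hγ : γ ∈ Γ) :
    (fun z => f (bdry γ z)) =ᵐ[m] f := by
  have hB := TopologicalSpace.countable_countableBasis ℂ
  have h1 : ∀ᵐ z ∂m, ∀ B ∈ TopologicalSpace.countableBasis ℂ,
      (f z ∈ B ↔ f (bdry γ z) ∈ B) := by
    rw [ae_ball_iff hB]
    intro B hB'
    have h2 := (hf (TopologicalSpace.isOpen_of_mem_countableBasis hB').measurableSet).2 γ hγ
    rw [measure_symmDiff_eq_zero_iff] at h2
    filter_upwards [h2] with z hz
    exact iff_of_eq hz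
  filter_upwards [h1] with z hz
  by_contra hne
  obtain ⟨U, V, hU, hV, hzU, hzV, hd⟩ := t2_separation hne
  obtain ⟨B, hB', hzB, hBU⟩ :=
    (TopologicalSpace.isBasis_countableBasis ℂ).exists_subset_of_mem_open hzU hU
  exact hd.le_bot ⟨hBU ((hz B hB').2 hzB), hzV⟩

theorem aestronglyMeasurable_invSigma {Γ : Subgroup diskAut} {p : ℝ≥0∞} {f : Lp ℂ p m}
    (hf : f ∈ LpInv Γ p) : AEStronglyMeasurable[invSigma Γ] f m :=
  (measurable_invSigma_of_comp (Lp.stronglyMeasurable f).measurable hf).stronglyMeasurable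
    |>.aestronglyMeasurable

theorem coeFn_Psi (Γ : Subgroup diskAut) {p : ℝ≥0∞} [Fact (1 ≤ p)] (f : Lp ℂ p m) :
    Psi Γ p f =ᵐ[m] m[f | invSigma Γ] :=
  MemLp.coeFn_toLp _

theorem Psi_mem_LpInv (Γ : Subgroup diskAut) {p : ℝ≥0∞} [Fact (1 ≤ p)] (f : Lp ℂ p m) :
    Psi Γ p f ∈ LpInv Γ p := fun γ hγ => by
  have h := coeFn_Psi Γ f
  refine ((quasiMeasurePreserving_bdry γ).ae_eq_comp h).trans (.trans ?_ h.symm)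
  exact comp_ae_eq_of_measurable_invSigma (stronglyMeasurable_condExp (m := invSigma Γ)).measurable hγ

theorem Psi_eq_self {Γ : Subgroup diskAut} {p : ℝ≥0∞} [Fact (1 ≤ p)] {f : Lp ℂ p m}
    (hf : f ∈ LpInv Γ p) : Psi Γ p f = f := by
  refine Lp.ext ((coeFn_Psi Γ f).trans ?_)
  exact condExp_of_aestronglyMeasurable' (invSigma_le Γ) (aestronglyMeasurable_invSigma hf)
    (integrable_coe f)

theorem norm_Psi_le (Γ : Subgroup diskAut) {p : ℝ≥0∞} [Fact (1 ≤ p)] (f : Lp ℂ p m) :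
    ‖Psi Γ p f‖ ≤ ‖f‖ := by
  rw [Lp.norm_def, Lp.norm_def, eLpNorm_congr_ae (coeFn_Psi Γ f)]
  exact ENNReal.toReal_mono (Lp.eLpNorm_ne_top f) (eLpNorm_condExp_le_eLpNorm f Fact.out)

/-- The conditional expectation as a continuous linear map. -/
def PsiL (Γ : Subgroup diskAut) (p : ℝ≥0∞) [Fact (1 ≤ p)] : Lp ℂ p m →L[ℂ] Lp ℂ p m :=
  LinearMap.mkContinuous
    { toFun := Psi Γ p
      map_add' := fun f g => by
        refine Lp.ext ?_
        refine (coeFn_Psi Γ _).trans ((condExp_congr_ae (Lp.coeFn_add f g)).trans ?_)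
        refine (condExp_add (integrable_coe f) (integrable_coe g) _).trans ?_
        refine .trans ?_ (Lp.coeFn_add _ _).symm
        filter_upwards [coeFn_Psi Γ f, coeFn_Psi Γ g] with z h1 h2
        simp [h1, h2]
      map_smul' := fun c f => by
        refine Lp.ext ?_
        refine (coeFn_Psi Γ _).trans ((condExp_congr_ae (Lp.coeFn_smul c f)).trans ?_)
        refine (condExp_smul c f _).trans ?_
        refine .trans ?_ (Lp.coeFn_smul _ _).symm
        filter_upwards [coeFn_Psi Γ f] with z h1
        simp [h1] }
    1 fun f => by simpa using norm_Psi_le Γ f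

@[simp]
theorem PsiL_apply (Γ : Subgroup diskAut) (p : ℝ≥0∞) [Fact (1 ≤ p)] (f : Lp ℂ p m) :
    PsiL Γ p f = Psi Γ p f := rfl

theorem isClosed_LpInv (Γ : Subgroup diskAut) (p : ℝ≥0∞) [Fact (1 ≤ p)] :
    IsClosed (LpInv Γ p : Set (Lp ℂ p m)) := by
  have : (LpInv Γ p : Set (Lp ℂ p m)) = {f | PsiL Γ p f = f} := by
    ext f
    exact ⟨fun hf => Psi_eq_self hf, fun hf => by
      have h := Psi_mem_LpInv Γ f
      rwa [← PsiL_apply, show PsiL Γ p f = f from hf] at h⟩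
  rw [this]
  exact isClosed_eq (PsiL Γ p).continuous continuous_id

/-- The conditional expectation is self-adjoint for the bilinear pairing. -/
theorem integral_Psi_mul {Γ : Subgroup diskAut} {p q : ℝ≥0∞} [Fact (1 ≤ p)] [Fact (1 ≤ q)]
    [ENNReal.HolderConjugate p q] (f : Lp ℂ p m) {g : Lp ℂ q m} (hg : g ∈ LpInv Γ q) :
    ∫ z, Psi Γ p f z * g z ∂m = ∫ z, f z * g z ∂m := by
  have h1 := condExp_bilin_of_aestronglyMeasurable_right (ContinuousLinearMap.mul ℝ ℂ)
    (aestronglyMeasurable_invSigma hg) (integrable_mul_of_holderConjugate f g) (integrable_coe f)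
  rw [← integral_condExp (invSigma_le Γ) (f := fun z => f z * g z)]
  refine integral_congr_ae ?_
  filter_upwards [h1, coeFn_Psi Γ f] with z hz hz'
  rw [hz']
  exact hz.symm

/-! ### Inclusions between Lebesgue spaces -/

/-- The inclusion of `L^p` into `L^q` for `q ≤ p`. -/
def incl {p q : ℝ≥0∞} (h : q ≤ p) : Lp ℂ p m →ₗ[ℂ] Lp ℂ q m where
  toFun f := ((Lp.memLp f).mono_exponent h).toLp f
  map_add' f g := by
    refine Lp.ext ((MemLp.coeFn_toLp _).trans ((Lp.coeFn_add f g).trans ?_))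
    refine .trans ?_ (Lp.coeFn_add _ _).symm
    exact (MemLp.coeFn_toLp _).symm.add (MemLp.coeFn_toLp _).symm
  map_smul' c f := by
    refine Lp.ext ((MemLp.coeFn_toLp _).trans ((Lp.coeFn_smul c f).trans ?_))
    refine .trans ?_ (Lp.coeFn_smul _ _).symm
    exact (MemLp.coeFn_toLp ((Lp.memLp f).mono_exponent h)).symm.const_smul c

theorem coeFn_incl {p q : ℝ≥0∞} (h : q ≤ p) (f : Lp ℂ p m) : incl h f =ᵐ[m] f :=
  ((Lp.memLp f).mono_exponent h).coeFn_toLp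

theorem incl_mem_LpInv {Γ : Subgroup diskAut} {p q : ℝ≥0∞} (h : q ≤ p) {f : Lp ℂ p m} :
    incl h f ∈ LpInv Γ q ↔ f ∈ LpInv Γ p := by
  refine forall₂_congr fun γ _ => ?_
  have h1 := coeFn_incl h f
  have h2 := (quasiMeasurePreserving_bdry γ).ae_eq_comp h1
  exact ⟨fun h3 => h2.symm.trans (h3.trans h1), fun h3 => h2.trans (h3.trans h1.symm)⟩

theorem incl_mem_fourierVanish {p q : ℝ≥0∞} [Fact (1 ≤ p)] [Fact (1 ≤ q)] (h : q ≤ p) {a : ℤ}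
    {f : Lp ℂ p m} : incl h f ∈ fourierVanish q a ↔ f ∈ fourierVanish p a := by
  refine forall₂_congr fun n _ => ?_
  rw [integral_congr_ae]
  filter_upwards [coeFn_incl h f] with z hz
  rw [hz]

theorem incl_Psi (Γ : Subgroup diskAut) {p q : ℝ≥0∞} [Fact (1 ≤ p)] [Fact (1 ≤ q)] (h : q ≤ p)
    (f : Lp ℂ p m) : incl h (Psi Γ p f) = Psi Γ q (incl h f) :=
  Lp.ext ((coeFn_incl h _).trans ((coeFn_Psi Γ f).trans
    ((condExp_congr_ae (coeFn_incl h f).symm).trans (coeFn_Psi Γ _).symm)))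

theorem incl_defectVec (Γ : Subgroup diskAut) {p q : ℝ≥0∞} [Fact (1 ≤ p)] [Fact (1 ≤ q)]
    (h : q ≤ p) (γ : diskAut) : incl h (defectVec Γ p γ) = defectVec Γ q γ := by
  rw [defectVec, defectVec, map_smul, incl_Psi]
  congr 2
  exact Lp.ext ((coeFn_incl h _).trans ((MemLp.coeFn_toLp _).trans (MemLp.coeFn_toLp _).symm))

/-- The defect spaces for all exponents are one space of bounded functions; this carries finite
dimensionality and decompositions from one exponent to another. -/
theorem map_incl_defectSpace (Γ : Subgroup diskAut) {p q : ℝ≥0∞} [Fact (1 ≤ p)] [Fact (1 ≤ q)]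
    (h : q ≤ p) : (defectSpace Γ p).map (incl h) = defectSpace Γ q := by
  rw [defectSpace, Submodule.map_span, defectSpace]
  congr 1
  ext v
  constructor
  · rintro ⟨_, ⟨γ, hγ, rfl⟩, rfl⟩
    exact ⟨γ, hγ, incl_defectVec Γ h γ⟩
  · rintro ⟨γ, hγ, rfl⟩
    exact ⟨_, ⟨γ, hγ, rfl⟩, incl_defectVec Γ h γ⟩

theorem defectSpace_le_LpInv (Γ : Subgroup diskAut) (p : ℝ≥0∞) [Fact (1 ≤ p)] :
    defectSpace Γ p ≤ LpInv Γ p := by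
  rw [defectSpace, Submodule.span_le]
  rintro _ ⟨γ, _, rfl⟩
  exact (LpInv Γ p).smul_mem _ (Psi_mem_LpInv Γ _)

theorem finiteDimensional_defectSpace {Γ : Subgroup diskAut} (hΓ : IsAdmissible Γ) (p : ℝ≥0∞)
    [Fact (1 ≤ p)] : FiniteDimensional ℂ (defectSpace Γ p) := by
  have := hΓ.2
  rw [← map_incl_defectSpace Γ (le_top : p ≤ ∞)]
  infer_instance

/-! ### The defect vectors -/

/-- The function is the density of the pushforward of `m` under `γ`, and an invariant `E` has the
same measure as its preimage, so the integral over `E` is `m E`. -/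
theorem condExp_szego_add_conj {Γ : Subgroup diskAut} {γ : diskAut} (hγ : γ ∈ Γ) :
    m[fun z => szego (γ.1 0) z + conj (szego (γ.1 0) z) - 1 | invSigma Γ] =ᵐ[m] fun _ => (1 : ℂ) := by
  have hc := continuous_szego (γ.1 0)
  refine (ae_eq_condExp_of_forall_setIntegral_eq (invSigma_le Γ)
    (integrable_of_continuous (by fun_prop)) (fun _ _ _ => (integrable_const _).integrableOn)
    (fun E hE _ => ?_) aestronglyMeasurable_const).symm
  have hEm := hE.1
  have h1 := integral_comp_bdry γ (f := E.indicator fun _ => (1 : ℂ))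
    (aestronglyMeasurable_const.indicator hEm)
  have h2 : ∫ z, E.indicator (fun _ => (1 : ℂ)) (bdry γ z) ∂m =
      ∫ z, E.indicator (fun _ => (1 : ℂ)) z ∂m := by
    refine integral_congr_ae ?_
    filter_upwards [measure_symmDiff_eq_zero_iff.1 (hE.2 γ hγ)] with z hz
    have hz' : z ∈ E ↔ bdry γ z ∈ E := iff_of_eq hz
    by_cases h : z ∈ E
    · simp [h, hz'.1 h]
    · simp [h, (not_congr hz').1 h]
  rw [← integral_indicator hEm, ← integral_indicator hEm, ← h2, h1]
  congr 1
  ext z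
  by_cases h : z ∈ E <;> simp [h]

/-- The function `k_w - 1` as an element of `L^p`. -/
def szegoSub (w : 𝔻) (p : ℝ≥0∞) : Lp ℂ p m :=
  (memLp_of_continuous ((continuous_szego w).sub continuous_const) p).toLp fun z => szego w z - 1

theorem coeFn_szegoSub (w : 𝔻) (p : ℝ≥0∞) : szegoSub w p =ᵐ[m] fun z => szego w z - 1 :=
  MemLp.coeFn_toLp _

theorem diffContOnCl_szego_sub (w : 𝔻) :
    DiffContOnCl ℂ (fun z : ℂ => 1 / (1 - conj (w : ℂ) * z) - 1) (Metric.ball 0 1) := by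
  constructor
  · exact (DifferentiableOn.div (by fun_prop) (by fun_prop) fun z hz =>
      one_sub_ne_zero w.norm_lt_one (mem_ball_zero_iff.1 hz).le).sub_const 1
  · rw [closure_ball _ one_ne_zero]
    exact (ContinuousOn.div (by fun_prop) (by fun_prop) fun z hz =>
      one_sub_ne_zero w.norm_lt_one (mem_closedBall_zero_iff.1 hz)).sub continuousOn_const

theorem szegoSub_mem_Hp0 (w : 𝔻) (p : ℝ≥0∞) [Fact (1 ≤ p)] : szegoSub w p ∈ Hp0 p :=
  mem_fourierVanish_one_of_diffContOnCl (diffContOnCl_szego_sub w) (by simp) _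

/-- Write `k - conj k = 2 (k - 1) - (k + conj k - 1) + 1`; under `Ψ` the last two terms cancel. Thus
`N` is spanned by images of functions in `H^p_0`. -/
theorem defectVec_eq {Γ : Subgroup diskAut} {γ : diskAut} (hγ : γ ∈ Γ) (p : ℝ≥0∞)
    [Fact (1 ≤ p)] : defectVec Γ p γ = (-(2 * I)) • Psi Γ p (szegoSub (γ.1 0) p) := by
  have h1 : Psi Γ p ((memLp_szego_sub (γ.1 0) p).toLp _) =
      (2 : ℂ) • Psi Γ p (szegoSub (γ.1 0) p) := by
    have hc := continuous_szego (γ.1 0)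
    refine Lp.ext ?_
    have h2 : (fun z => szego (γ.1 0) z - conj (szego (γ.1 0) z)) =
        ((2 : ℂ) • (fun z => szego (γ.1 0) z - 1) -
          fun z => szego (γ.1 0) z + conj (szego (γ.1 0) z) - 1) + fun _ => (1 : ℂ) := by
      ext z
      simp only [Pi.add_apply, Pi.sub_apply, Pi.smul_apply, smul_eq_mul]
      ring
    have i1 : Integrable (fun z => szego (γ.1 0) z - 1) m :=
      integrable_of_continuous (by fun_prop)
    have i2 : Integrable (fun z => szego (γ.1 0) z + conj (szego (γ.1 0) z) - 1) m :=
      integrable_of_continuous (by fun_prop)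
    refine (coeFn_Psi Γ _).trans ((condExp_congr_ae (MemLp.coeFn_toLp _)).trans ?_)
    rw [h2]
    refine (condExp_add ((i1.smul (2 : ℂ)).sub i2) (integrable_const _) _).trans ?_
    filter_upwards [condExp_sub (i1.smul (2 : ℂ)) i2 (invSigma Γ),
      condExp_smul (μ := m) (2 : ℂ) (fun z => szego (γ.1 0) z - 1) (invSigma Γ),
      condExp_szego_add_conj hγ, Lp.coeFn_smul (2 : ℂ) (Psi Γ p (szegoSub (γ.1 0) p)),
      coeFn_Psi Γ (szegoSub (γ.1 0) p),
      condExp_congr_ae (m := invSigma Γ) (coeFn_szegoSub (γ.1 0) p)] with z a1 a2 a3 a4 a5 a6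
    rw [Pi.add_apply, a1, Pi.sub_apply, a2, a3, a4, condExp_const (invSigma_le Γ), Pi.smul_apply,
      Pi.smul_apply, a5, a6]
    ring
  rw [defectVec, h1, smul_smul]
  congr 1
  ring

/-! ### The Hilbert space case -/

theorem isClosed_fourierVanish (p : ℝ≥0∞) [Fact (1 ≤ p)] (a : ℤ) :
    IsClosed (fourierVanish p a : Set (Lp ℂ p m)) := by
  have : ENNReal.HolderConjugate p p.conjExponent := .conjExponent Fact.out
  have : Fact (1 ≤ p.conjExponent) := ⟨ENNReal.HolderConjugate.one_le _ p⟩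
  have h1 : (fourierVanish p a : Set (Lp ℂ p m)) = ⋂ n : ℤ, ⋂ _ : n < a,
      {f | (Lp.pairing p p.conjExponent).flip
        ((memLp_of_continuous (continuous_coe_zpow (-n)) p.conjExponent).toLp _) f = 0} := by
    ext f
    simp only [Set.mem_iInter, Set.mem_ofPred_eq]
    refine forall₂_congr fun n _ => ?_
    rw [ContinuousLinearMap.flip_apply, Lp.pairing_apply]
    refine iff_of_eq (congrArg (· = (0 : ℂ)) (integral_congr_ae ?_))
    filter_upwards [(memLp_of_continuous (continuous_coe_zpow (-n)) p.conjExponent).coeFn_toLp]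
      with z hz
    rw [hz, mul_comm]
  rw [h1]
  exact isClosed_iInter fun n => isClosed_iInter fun _ =>
    isClosed_eq (ContinuousLinearMap.continuous _) continuous_const

theorem conj_monomial (n : ℤ) (z : Circle) :
    conj ((z ^ n : Circle) : ℂ) = ((z ^ (-n) : Circle) : ℂ) := by
  rw [zpow_neg, Circle.coe_inv_eq_conj]

theorem integral_monomial_mul_conj (n : ℤ) (f : Circle → ℂ) :
    ∫ z, ((z ^ n : Circle) : ℂ) * conj (f z) ∂m =
      conj (∫ z, ((z ^ (-n) : Circle) : ℂ) * f z ∂m) := by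
  rw [← integral_conj]
  simp_rw [map_mul, conj_monomial, neg_neg]

/-- Orthogonality to the monomials of exponent `≥ 0` kills those coefficients of `b`; conjugation
reflects them to the indices `≤ 0`, including `0`. -/
theorem star_mem_fourierVanish_one {b : Lp ℂ 2 m} (hb : b ∈ (Hp 2)ᗮ) :
    star b ∈ fourierVanish 2 1 := by
  intro n hn
  have hm := memLp_of_continuous (continuous_coe_zpow (-n)) 2
  have h1 : hm.toLp _ ∈ Hp 2 := by
    rw [Hp, mem_fourierVanish_toLp]
    intro k hk
    obtain ⟨j, hj⟩ : ∃ j : ℕ, -k + -n = j := ⟨(-k + -n).toNat, by omega⟩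
    simp_rw [← Circle.coe_mul, ← zpow_add, hj, zpow_natCast, Circle.coe_pow]
    exact integral_coe_pow (by omega)
  have h2 := (Submodule.mem_orthogonal _ _).1 hb _ h1
  rw [L2.inner_def] at h2
  have h3 : ∫ z, ((z ^ (-n) : Circle) : ℂ) * star b z ∂m =
      ∫ z, ((z ^ (-n) : Circle) : ℂ) * conj (b z) ∂m := by
    refine integral_congr_ae ?_
    filter_upwards [Lp.coeFn_star b] with z hz
    rw [hz]
    rfl
  rw [h3, integral_monomial_mul_conj, neg_neg, ← map_zero (starRingEnd ℂ), ← h2]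
  congr 1
  refine integral_congr_ae ?_
  filter_upwards [hm.coeFn_toLp] with z hz
  rw [hz, RCLike.inner_apply, conj_monomial, neg_neg, mul_comm]

theorem coeFn_star_conj {p : ℝ≥0∞} (b : Lp ℂ p m) :
    (star b : Lp ℂ p m) =ᵐ[m] fun z => conj (b z) :=
  Lp.coeFn_star b

theorem star_mem_LpInv {Γ : Subgroup diskAut} {p : ℝ≥0∞} {b : Lp ℂ p m} (hb : b ∈ LpInv Γ p) :
    star b ∈ LpInv Γ p := fun γ hγ => by
  have h := coeFn_star_conj b
  filter_upwards [h, (quasiMeasurePreserving_bdry γ).ae_eq_comp h, hb γ hγ] with z h1 h2 h3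
  simp only [Function.comp_apply] at h2
  rw [h1, h2, h3]

theorem const_mem_HpInv (Γ : Subgroup diskAut) (p : ℝ≥0∞) [Fact (1 ≤ p)] :
    (memLp_const (1 : ℂ) : MemLp (fun _ => (1 : ℂ)) p m).toLp _ ∈ HpInv Γ p := by
  constructor
  · rw [Hp, SetLike.mem_coe, mem_fourierVanish_toLp]
    intro n hn
    obtain ⟨j, hj⟩ : ∃ j : ℕ, -n = j := ⟨(-n).toNat, by omega⟩
    simp_rw [mul_one, hj, zpow_natCast, Circle.coe_pow]
    exact integral_coe_pow (by omega)
  · intro γ _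
    have h := (memLp_const (1 : ℂ) : MemLp (fun _ => (1 : ℂ)) p m).coeFn_toLp
    exact ((quasiMeasurePreserving_bdry γ).ae_eq_comp h).trans h.symm

theorem mem_Hp0_iff {p : ℝ≥0∞} [Fact (1 ≤ p)] {f : Lp ℂ p m} :
    f ∈ Hp0 p ↔ f ∈ Hp p ∧ ∫ z, f z ∂m = 0 := by
  constructor
  · intro h
    refine ⟨fourierVanish_anti zero_le_one h, ?_⟩
    simpa using h 0 zero_lt_one
  · rintro ⟨h, h0⟩ n hn
    rcases (show n ≤ 0 by omega).lt_or_eq with h1 | rfl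
    · exact h n h1
    · simpa using h0

/-- The antianalytic part of an invariant function orthogonal to the defect vectors is invariant. -/
theorem antianalytic_part_mem_LpInv {Γ : Subgroup diskAut} {a b : Lp ℂ 2 m}
    (hab : a + b ∈ LpInv Γ 2) (ha : a ∈ Hp 2) (hb : star b ∈ Hp0 2)
    (hN : ∀ γ ∈ Γ, ∫ z, (szego (γ.1 0) z - 1) * (a + b : Lp ℂ 2 m) z ∂m = 0) :
    b ∈ LpInv Γ 2 := by
  intro γ hγ
  have hqm := quasiMeasurePreserving_bdry γ
  have hF := diffContOnCl_szego_sub (γ.1 0)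
  have hsc : Continuous fun z : Circle => szego (γ.1 0) z - 1 :=
    (continuous_szego _).sub continuous_const
  have hb0 := (mem_Hp0_iff.1 hb).2
  have hbH := (mem_Hp0_iff.1 hb).1
  have hstar := coeFn_star_conj b
  have hconj : ∀ n : ℤ, ∫ z, ((z ^ n : Circle) : ℂ) * b z ∂m =
      conj (∫ z, ((z ^ (-n) : Circle) : ℂ) * star b z ∂m) := fun n => by
    rw [← integral_conj]
    refine integral_congr_ae ?_
    filter_upwards [hstar] with z hz
    rw [hz, map_mul, conj_monomial, neg_neg, conj_conj]
  have hconj' : ∀ n : ℤ, ∫ z, ((z ^ n : Circle) : ℂ) * b (bdry γ z) ∂m =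
      conj (∫ z, ((z ^ (-n) : Circle) : ℂ) * star b (bdry γ z) ∂m) := fun n => by
    rw [← integral_conj]
    refine integral_congr_ae ?_
    filter_upwards [hqm.ae_eq_comp hstar] with z hz
    simp only [Function.comp_apply] at hz
    rw [hz, map_mul, conj_monomial, neg_neg, conj_conj]
  have hbmean : ∫ z, b z ∂m = 0 := by
    have := hconj 0
    simpa [hb0] using this
  -- The only place where the defect vectors enter. The Poisson kernel splits as `(k - 1) + conj k`.
  -- The first term sees only `b`, because `(k - 1) a` has integral zero; the second pairs `b` with
  -- another antianalytic function.
  have hbcomp : ∫ z, b (bdry γ z) ∂m = 0 := by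
    rw [integral_comp_bdry γ (Lp.aestronglyMeasurable b)]
    have e1 : ∫ z, (szego (γ.1 0) z - 1) * b z ∂m = 0 := by
      have h1 := hN γ hγ
      have h2 : ∫ z, (szego (γ.1 0) z - 1) * a z ∂m = 0 :=
        integral_diffContOnCl_mul_eq_zero hF (by simp) ha
      have h3 : ∫ z, (szego (γ.1 0) z - 1) * (a + b : Lp ℂ 2 m) z ∂m =
          ∫ z, (szego (γ.1 0) z - 1) * a z ∂m + ∫ z, (szego (γ.1 0) z - 1) * b z ∂m := by
        rw [← integral_add (integrable_continuous_mul (integrable_coe a) hsc)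
          (integrable_continuous_mul (integrable_coe b) hsc)]
        refine integral_congr_ae ?_
        filter_upwards [Lp.coeFn_add a b] with z hz
        rw [hz, Pi.add_apply, mul_add]
      rwa [h3, h2, zero_add] at h1
    have e2 : ∫ z, conj (szego (γ.1 0) z) * b z ∂m = 0 := by
      have h2 : ∫ z, (szego (γ.1 0) z - 1) * star b z ∂m = 0 :=
        integral_diffContOnCl_mul_eq_zero hF (by simp) hbH
      have h3 : ∫ z, conj (szego (γ.1 0) z) * b z ∂m =
          conj (∫ z, ((szego (γ.1 0) z - 1) * star b z + star b z) ∂m) := by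
        rw [← integral_conj]
        refine integral_congr_ae ?_
        filter_upwards [hstar] with z hz
        rw [hz, sub_mul, one_mul, sub_add_cancel, map_mul, conj_conj]
      rw [h3, integral_add (integrable_continuous_mul (integrable_coe _) hsc) (integrable_coe _),
        h2, hb0, add_zero, map_zero]
    have e3 : ∀ z, (szego (γ.1 0) z + conj (szego (γ.1 0) z) - 1) * b z =
        (szego (γ.1 0) z - 1) * b z + conj (szego (γ.1 0) z) * b z := fun z => by ring
    have hcc : Continuous fun z => conj (szego (γ.1 0) z) :=
      Complex.continuous_conj.comp (continuous_szego _)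
    simp_rw [e3]
    rw [integral_add (integrable_continuous_mul (integrable_coe b) hsc)
      (integrable_continuous_mul (integrable_coe b) hcc), e1, e2, add_zero]
  have hib : Integrable (fun z => b (bdry γ z)) m :=
    (memLp_comp_bdry γ (Lp.memLp b)).integrable one_le_two
  have hia : Integrable (fun z => a (bdry γ z)) m :=
    (memLp_comp_bdry γ (Lp.memLp a)).integrable one_le_two
  have hae : (fun z => b (bdry γ z) - b z) =ᵐ[m] fun z => a z - a (bdry γ z) := by
    filter_upwards [hab γ hγ, Lp.coeFn_add a b, hqm.ae_eq_comp (Lp.coeFn_add a b)] with z h1 h2 h3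
    simp only [Function.comp_apply, Pi.add_apply] at h2 h3
    rw [h2, h3] at h1
    linear_combination h1
  have hz : (fun z => b (bdry γ z) - b z) =ᵐ[m] 0 := by
    refine ae_eq_zero_of_fourier (hib.sub (integrable_coe b)) fun n => ?_
    -- Multiplying by `z ^ n` extracts the coefficient of index `-n`: for `n < 0` it vanishes
    -- because `b` and `b ∘ γ` are antianalytic, for `n = 0` by the two means, for `n > 0` because
    -- `a` and `a ∘ γ` are analytic.
    rcases lt_trichotomy n 0 with hn | rfl | hn
    · simp_rw [mul_sub]
      rw [integral_sub (integrable_continuous_mul hib (continuous_coe_zpow n))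
        (integrable_continuous_mul (integrable_coe b) (continuous_coe_zpow n)), hconj, hconj',
        integral_monomial_comp_bdry γ hbH hn, hbH n hn, sub_self]
    · simp only [zpow_zero, Circle.coe_one, one_mul]
      rw [integral_sub hib (integrable_coe b), hbmean, hbcomp, sub_zero]
    · have h1 := integral_monomial_comp_bdry γ ha (n := -n) (by omega)
      have h2 := ha (-n) (by omega)
      rw [neg_neg] at h1 h2
      have h3 : ∫ z, ((z ^ n : Circle) : ℂ) * (b (bdry γ z) - b z) ∂m =
          ∫ z, (((z ^ n : Circle) : ℂ) * a z - ((z ^ n : Circle) : ℂ) * a (bdry γ z)) ∂m := by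
        refine integral_congr_ae ?_
        filter_upwards [hae] with z hz
        rw [hz, mul_sub]
      rw [h3, integral_sub (integrable_continuous_mul (integrable_coe a) (continuous_coe_zpow n))
        (integrable_continuous_mul hia (continuous_coe_zpow n)), h1, h2, sub_zero]
  filter_upwards [hz] with z hz
  exact sub_eq_zero.1 hz

/-- An invariant square integrable function orthogonal to `H²_Γ` and to the defect vectors lies in
`H²_0`. -/
theorem mem_Hp0_two {Γ : Subgroup diskAut} {g : Lp ℂ 2 m} (hg : g ∈ LpInv Γ 2)
    (hH : ∀ h ∈ HpInv Γ 2, ∫ z, h z * g z ∂m = 0)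
    (hN : ∀ γ ∈ Γ, ∫ z, (szego (γ.1 0) z - 1) * g z ∂m = 0) : g ∈ Hp0 2 := by
  have hcl : IsClosed (Hp 2 : Set (Lp ℂ 2 m)) := isClosed_fourierVanish 2 0
  have : CompleteSpace (Hp 2) := hcl.completeSpace_coe
  obtain ⟨a, ha, b, hb, rfl⟩ := (Hp 2).exists_add_mem_mem_orthogonal g
  have hb1 : star b ∈ Hp0 2 := star_mem_fourierVanish_one hb
  have hbΓ := antianalytic_part_mem_LpInv hg ha hb1 hN
  -- Pairing with `conj b`, now known to lie in `H^2_Γ`, leaves `∫ |b|^2 = 0`, since `conj b * a`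
  -- has integral zero.
  have h1 := hH (star b) ⟨(mem_Hp0_iff.1 hb1).1, star_mem_LpInv hbΓ⟩
  have h2 := integral_mul_eq_zero (p := 2) (q := 2) (by norm_num) hb1 ha
  have h3 : inner ℂ b b = 0 := by
    rw [← Lp.pairing_apply, map_add, Lp.pairing_apply, Lp.pairing_apply, h2, zero_add] at h1
    rw [L2.inner_def, ← h1]
    refine integral_congr_ae ?_
    filter_upwards [coeFn_star_conj b] with z hz
    rw [hz, RCLike.inner_apply, mul_comm]
  have hb0 : b = 0 := inner_self_eq_zero.1 h3
  rw [hb0, add_zero] at hH ⊢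
  refine mem_Hp0_iff.2 ⟨ha, ?_⟩
  -- The mean of `a` vanishes because constants belong to `H^2_Γ`.
  rw [← hH _ (const_mem_HpInv Γ 2)]
  refine integral_congr_ae ?_
  filter_upwards [(memLp_const (1 : ℂ) : MemLp (fun _ => (1 : ℂ)) 2 m).coeFn_toLp] with z hz
  rw [hz, one_mul]

end FuchsianHardy
end

/-! ### Representation by symmetric forms, separation, and the proof of both assertions -/

noncomputable section

/-- A functional vanishing on the radical of a symmetric bilinear form on a finite dimensional
space is represented by the form. -/
theorem LinearMap.exists_eq_of_ker_le {K V : Type*} [Field K] [AddCommGroup V] [Module K V]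
    [FiniteDimensional K V] (B : V →ₗ[K] Module.Dual K V) (hB : ∀ x y, B x y = B y x)
    (φ : Module.Dual K V) (hφ : ∀ x, B x = 0 → φ x = 0) : ∃ x, B x = φ := by
  have hle : LinearMap.range B ≤ (LinearMap.ker B).dualAnnihilator := by
    rintro _ ⟨x, rfl⟩
    rw [Submodule.mem_dualAnnihilator]
    intro y hy
    rw [hB, LinearMap.mem_ker.1 hy, LinearMap.zero_apply]
  -- Symmetry gives one inclusion between the range and the annihilator of the radical; equality is
  -- rank-nullity.
  have heq := Submodule.eq_of_le_of_finrank_eq hle (by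
    have h1 := LinearMap.finrank_range_add_finrank_ker B
    have h2 := Subspace.finrank_add_finrank_dualAnnihilator_eq (LinearMap.ker B)
    omega)
  have : φ ∈ LinearMap.range B := by
    rw [heq, Submodule.mem_dualAnnihilator]
    exact fun y hy => hφ y (LinearMap.mem_ker.1 hy)
  exact this

/-- A point outside a closed subspace is separated from it by a functional. -/
theorem Submodule.exists_strongDual_ne_zero {E : Type*} [NormedAddCommGroup E] [NormedSpace ℂ E]
    {S : Submodule ℂ E} (hS : IsClosed (S : Set E)) {x : E} (hx : x ∉ S) :
    ∃ φ : StrongDual ℂ E, (∀ y ∈ S, φ y = 0) ∧ φ x ≠ 0 := by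
  have : IsClosed (S : Set E) := hS
  have h0 : S.mkQ x ≠ 0 := by simpa using hx
  obtain ⟨ψ, hψ⟩ := SeparatingDual.exists_ne_zero (R := ℂ) h0
  refine ⟨ψ.comp S.mkQL, fun y hy => ?_, hψ⟩
  have : S.mkQ y = 0 := by simpa using hy
  change ψ (S.mkQ y) = 0
  rw [this, map_zero]

namespace FuchsianHardy

/-! ### The image of the Hardy space under the conditional expectation -/

theorem Psi_szegoSub_mem_defectSpace {Γ : Subgroup diskAut} {γ : diskAut} (hγ : γ ∈ Γ)
    (p : ℝ≥0∞) [Fact (1 ≤ p)] : Psi Γ p (szegoSub (γ.1 0) p) ∈ defectSpace Γ p := by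
  have h : defectVec Γ p γ ∈ defectSpace Γ p := Submodule.subset_span ⟨γ, hγ, rfl⟩
  rw [defectVec_eq hγ] at h
  exact (Submodule.smul_mem_iff _ (by simp)).1 h

theorem integral_mul_comm_Psi {Γ : Subgroup diskAut} {p q : ℝ≥0∞} [Fact (1 ≤ p)] [Fact (1 ≤ q)]
    [hpq : ENNReal.HolderConjugate p q] {f : Lp ℂ p m} (hf : f ∈ LpInv Γ p) (g : Lp ℂ q m) :
    ∫ z, f z * Psi Γ q g z ∂m = ∫ z, f z * g z ∂m := by
  have : ENNReal.HolderConjugate q p := hpq.symm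
  simp_rw [mul_comm (f _)]
  exact integral_Psi_mul g hf

/-- The exponent `1` comes first because a separating functional is then a bounded function, which
lies in `L^2`, where the splitting into analytic and antianalytic parts is an orthogonal projection.
-/
theorem Psi_mem_sup_one {Γ : Subgroup diskAut} (hΓ : IsAdmissible Γ) {f : Lp ℂ 1 m}
    (hf : f ∈ Hp 1) : Psi Γ 1 f ∈ HpInv Γ 1 ⊔ defectSpace Γ 1 := by
  have := finiteDimensional_defectSpace hΓ 1
  have hcl : IsClosed ((HpInv Γ 1 ⊔ defectSpace Γ 1 : Submodule ℂ (Lp ℂ 1 m)) : Set (Lp ℂ 1 m)) :=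
    Submodule.isClosed_sup_finiteDimensional _ _
      ((isClosed_fourierVanish 1 0).inter (isClosed_LpInv Γ 1))
  by_contra hmem
  obtain ⟨φ, hφ, hne⟩ := Submodule.exists_strongDual_ne_zero hcl hmem
  obtain ⟨g, hg⟩ := Lp.exists_eq_integral (q := ∞) ENNReal.one_ne_top φ
  -- On `L^1_Γ` the functional does not change when its density is replaced by the invariant
  -- function `Ψ g`.
  set G := Psi Γ ∞ g with hGdef
  have hG : G ∈ LpInv Γ ∞ := Psi_mem_LpInv Γ g
  have hφG : ∀ h ∈ LpInv Γ 1, φ h = ∫ z, h z * G z ∂m := fun h hh => by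
    rw [hg, hGdef, integral_mul_comm_Psi hh]
  have h2 : incl (le_top : (2 : ℝ≥0∞) ≤ ∞) G ∈ Hp0 2 := by
    refine mem_Hp0_two ((incl_mem_LpInv _).2 hG) (fun h hh => ?_) fun γ hγ => ?_
    · have h1 : incl one_le_two h ∈ HpInv Γ 1 :=
        ⟨(incl_mem_fourierVanish _).2 hh.1, (incl_mem_LpInv _).2 hh.2⟩
      rw [← hφ _ (Submodule.mem_sup_left h1), hφG _ h1.2]
      refine integral_congr_ae ?_
      filter_upwards [coeFn_incl (le_top : (2 : ℝ≥0∞) ≤ ∞) G, coeFn_incl one_le_two h]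
        with z hz hz'
      rw [hz, hz']
    · have h1 := Psi_szegoSub_mem_defectSpace hγ 1
      rw [← hφ _ (Submodule.mem_sup_right h1), hφG _ (Psi_mem_LpInv Γ _), integral_Psi_mul _ hG]
      refine integral_congr_ae ?_
      filter_upwards [coeFn_incl (le_top : (2 : ℝ≥0∞) ≤ ∞) G, coeFn_szegoSub (γ.1 0) 1]
        with z hz hz'
      rw [hz, hz']
  have h3 : G ∈ fourierVanish ∞ 1 := (incl_mem_fourierVanish _).1 h2
  refine hne ?_
  rw [hφG _ (Psi_mem_LpInv Γ _), integral_Psi_mul _ hG]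
  exact integral_mul_eq_zero (by norm_num) hf h3

theorem Psi_image_Hp {Γ : Subgroup diskAut} (hΓ : IsAdmissible Γ) (p : ℝ≥0∞) [hp : Fact (1 ≤ p)] :
    Psi Γ p '' (Hp p : Set (Lp ℂ p m)) =
      (HpInv Γ p ⊔ defectSpace Γ p : Submodule ℂ (Lp ℂ p m)) := by
  apply Set.Subset.antisymm
  · rintro _ ⟨f, hf, rfl⟩
    have h1 := Psi_mem_sup_one hΓ ((incl_mem_fourierVanish hp.out).2 hf)
    rw [← incl_Psi, ← map_incl_defectSpace Γ (hp.out), Submodule.mem_sup] at h1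
    obtain ⟨h, hh, _, ⟨n, hn, rfl⟩, hhn⟩ := h1
    -- The component `n` is bounded, so the analytic component found in `L^1` is in fact the element
    -- `Ψ f - n` of `L^p`.
    have h2 : incl hp.out (Psi Γ p f - n) = h := by
      rw [map_sub, ← hhn, add_sub_cancel_right]
    rw [← h2] at hh
    have h3 : Psi Γ p f - n ∈ HpInv Γ p :=
      ⟨(incl_mem_fourierVanish _).1 hh.1, (incl_mem_LpInv _).1 hh.2⟩
    exact Submodule.mem_sup.2 ⟨_, h3, n, hn, sub_add_cancel _ _⟩
  · have h1 : HpInv Γ p ⊔ defectSpace Γ p ≤ (Hp p).map (PsiL Γ p).toLinearMap := by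
      refine sup_le (fun h hh => ⟨h, hh.1, Psi_eq_self hh.2⟩) ?_
      rw [defectSpace, Submodule.span_le]
      rintro _ ⟨γ, hγ, rfl⟩
      rw [defectVec_eq hγ]
      exact Submodule.smul_mem _ _ ⟨_, (mem_Hp0_iff.1 (szegoSub_mem_Hp0 _ p)).1, rfl⟩
    exact h1

/-! ### Annihilators -/

section Annihilators

variable {Γ : Subgroup diskAut} {p q : ℝ≥0∞} [Fact (1 ≤ p)] [Fact (1 ≤ q)]
  [hpq : ENNReal.HolderConjugate p q]

/-- Against the invariant `h` the operator `Ψ` may be dropped, leaving `∫ h (k - 1) dm`, with `h`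
analytic and `k - 1` analytic of mean zero. -/
theorem integral_mul_defectSpace {h : Lp ℂ p m} (hh : h ∈ HpInv Γ p) {n : Lp ℂ q m}
    (hn : n ∈ defectSpace Γ q) : ∫ z, h z * n z ∂m = 0 := by
  have hle : defectSpace Γ q ≤ LinearMap.ker (Lp.pairing p q h).toLinearMap := by
    rw [defectSpace, Submodule.span_le]
    rintro _ ⟨γ, hγ, rfl⟩
    rw [defectVec_eq hγ]
    refine Submodule.smul_mem _ _ ?_
    change Lp.pairing p q h _ = 0
    rw [Lp.pairing_apply, integral_mul_comm_Psi hh.2]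
    exact integral_mul_eq_zero (by norm_num) hh.1 (szegoSub_mem_Hp0 _ q)
  rw [← Lp.pairing_apply]
  exact hle hn

/-- By (a) the sum is `Ψ(H^p)`, and self-adjointness of `Ψ` reduces the condition to annihilating
`H^p`; the monomials in `H^p` detect membership in `H^q_0`. -/
theorem annih_sup_defectSpace (hΓ : IsAdmissible Γ) :
    annih Γ q ((HpInv Γ p ⊔ defectSpace Γ p : Submodule ℂ (Lp ℂ p m)) : Set (Lp ℂ p m)) =
      Hp0Inv Γ q := by
  rw [← Psi_image_Hp hΓ]
  ext g
  constructor
  · rintro ⟨hg, h⟩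
    refine ⟨fun n hn => ?_, hg⟩
    have hm := memLp_of_continuous (continuous_coe_zpow (-n)) p
    have h1 : hm.toLp _ ∈ Hp p := by
      rw [Hp, mem_fourierVanish_toLp]
      intro k hk
      obtain ⟨j, hj⟩ : ∃ j : ℕ, -k + -n = j := ⟨(-k + -n).toNat, by omega⟩
      simp_rw [← Circle.coe_mul, ← zpow_add, hj, zpow_natCast, Circle.coe_pow]
      exact integral_coe_pow (by omega)
    have h2 := h _ ⟨_, h1, rfl⟩
    rw [integral_Psi_mul _ hg] at h2
    rw [← h2]
    refine integral_congr_ae ?_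
    filter_upwards [hm.coeFn_toLp] with z hz
    rw [hz]
  · rintro ⟨hg, hgΓ⟩
    refine ⟨hgΓ, ?_⟩
    rintro _ ⟨f, hf, rfl⟩
    rw [integral_Psi_mul _ hgΓ]
    exact integral_mul_eq_zero (by norm_num) hf hg

/-- This locates the radical of the pairing on `N`: such an `n` annihilates `N` by assumption and
`H^1_Γ` as a member of `N`. -/
theorem mem_Hp0Inv_top_of_orthogonal (hΓ : IsAdmissible Γ) {n : Lp ℂ ∞ m}
    (hn : n ∈ defectSpace Γ ∞)
    (h : ∀ n' ∈ defectSpace Γ ∞, ∫ z, n' z * n z ∂m = 0) : n ∈ Hp0Inv Γ ∞ := by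
  have : n ∈ annih Γ ∞
      ((HpInv Γ 1 ⊔ defectSpace Γ 1 : Submodule ℂ (Lp ℂ 1 m)) : Set (Lp ℂ 1 m)) := by
    refine ⟨defectSpace_le_LpInv Γ ∞ hn, fun f hf => ?_⟩
    obtain ⟨a, ha, b, hb, rfl⟩ := Submodule.mem_sup.1 hf
    rw [← Lp.pairing_apply, map_add, add_apply, Lp.pairing_apply, Lp.pairing_apply,
      integral_mul_defectSpace ha hn, zero_add]
    rw [← map_incl_defectSpace Γ (le_top : (1 : ℝ≥0∞) ≤ ∞)] at hb
    obtain ⟨n', hn', rfl⟩ := hb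
    rw [← h n' hn']
    refine integral_congr_ae ?_
    filter_upwards [coeFn_incl (le_top : (1 : ℝ≥0∞) ≤ ∞) n'] with z hz
    rw [hz]
  rw [annih_sup_defectSpace hΓ] at this
  exact this

/-- The functional `∫ · g dm` on `N` vanishes on the radical of the pairing, since the radical lies
in `H^p_Γ`; so the pairing with some `n` in `N` represents it. The form is set up on `N` inside
`L^∞`, independently of `p` and `q`. -/
theorem exists_defect_sub_orthogonal (hΓ : IsAdmissible Γ) {g : Lp ℂ q m}
    (hg : ∀ h ∈ HpInv Γ p, ∫ z, h z * g z ∂m = 0) :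
    ∃ n ∈ defectSpace Γ q, ∀ n' ∈ defectSpace Γ p, ∫ z, n' z * (g - n : Lp ℂ q m) z ∂m = 0 := by
  have := hΓ.2
  let V := defectSpace Γ ∞
  let B : V →ₗ[ℂ] Module.Dual ℂ V :=
    { toFun := fun x => (Lp.pairing 1 ∞ (incl le_top (x : Lp ℂ ∞ m))).toLinearMap ∘ₗ V.subtype
      map_add' := fun x y => by ext; simp
      map_smul' := fun c x => by ext; simp }
  have hB : ∀ x y : V, B x y = ∫ z, (x : Lp ℂ ∞ m) z * (y : Lp ℂ ∞ m) z ∂m := fun x y => by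
    change Lp.pairing 1 ∞ (incl le_top (x : Lp ℂ ∞ m)) (y : Lp ℂ ∞ m) = _
    rw [Lp.pairing_apply]
    refine integral_congr_ae ?_
    filter_upwards [coeFn_incl (le_top : (1 : ℝ≥0∞) ≤ ∞) (x : Lp ℂ ∞ m)] with z hz
    rw [hz]
  have hBs : ∀ x y : V, B x y = B y x := fun x y => by
    rw [hB, hB]
    simp_rw [mul_comm]
  let φ : Module.Dual ℂ V :=
    ((Lp.pairing p q).flip g).toLinearMap ∘ₗ incl le_top ∘ₗ V.subtype
  have hφ : ∀ x : V, φ x = ∫ z, incl (le_top : p ≤ ∞) (x : Lp ℂ ∞ m) z * g z ∂m := fun x =>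
    Lp.pairing_apply _ _
  obtain ⟨n, hn⟩ := LinearMap.exists_eq_of_ker_le B hBs φ fun x hx => by
    have hx' : (x : Lp ℂ ∞ m) ∈ Hp0Inv Γ ∞ :=
      mem_Hp0Inv_top_of_orthogonal hΓ x.2 fun n' hn' => by
        rw [← hB ⟨n', hn'⟩ x, hBs, hx, LinearMap.zero_apply]
    rw [hφ]
    exact hg _ ⟨(incl_mem_fourierVanish _).2 (mem_Hp0_iff.1 hx'.1).1, (incl_mem_LpInv _).2 hx'.2⟩
  refine ⟨incl le_top (n : Lp ℂ ∞ m), ?_, fun n' hn' => ?_⟩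
  · rw [← map_incl_defectSpace Γ (le_top : q ≤ ∞)]
    exact ⟨_, n.2, rfl⟩
  · rw [← map_incl_defectSpace Γ (le_top : p ≤ ∞)] at hn'
    obtain ⟨x, hx, rfl⟩ := hn'
    have h1 := LinearMap.congr_fun hn ⟨x, hx⟩
    rw [hBs, hB, hφ] at h1
    rw [← Lp.pairing_apply, map_sub, Lp.pairing_apply, Lp.pairing_apply, ← h1, sub_eq_zero]
    refine integral_congr_ae ?_
    filter_upwards [coeFn_incl (le_top : p ≤ ∞) x, coeFn_incl (le_top : q ≤ ∞) (n : Lp ℂ ∞ m)]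
      with z hz hz'
    rw [hz, hz']

theorem annih_HpInv (hΓ : IsAdmissible Γ) : annih Γ q (HpInv Γ p : Set (Lp ℂ p m)) =
    (Hp0Inv Γ q ⊔ defectSpace Γ q : Submodule ℂ (Lp ℂ q m)) := by
  ext g
  constructor
  · rintro ⟨hgΓ, hg⟩
    obtain ⟨n, hn, hn'⟩ := exists_defect_sub_orthogonal hΓ hg
    have h1 : g - n ∈ annih Γ q
        ((HpInv Γ p ⊔ defectSpace Γ p : Submodule ℂ (Lp ℂ p m)) : Set (Lp ℂ p m)) := by
      refine ⟨Submodule.sub_mem _ hgΓ (defectSpace_le_LpInv Γ q hn), fun f hf => ?_⟩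
      obtain ⟨a, ha, b, hb, rfl⟩ := Submodule.mem_sup.1 hf
      rw [← Lp.pairing_apply, map_add, add_apply, map_sub, Lp.pairing_apply, Lp.pairing_apply,
        Lp.pairing_apply, hg a ha, integral_mul_defectSpace ha hn, sub_zero, zero_add]
      exact hn' b hb
    rw [annih_sup_defectSpace hΓ] at h1
    exact Submodule.mem_sup.2 ⟨_, h1, n, hn, sub_add_cancel _ _⟩
  · intro hg
    obtain ⟨a, ha, n, hn, rfl⟩ := Submodule.mem_sup.1 hg
    refine ⟨Submodule.add_mem _ ha.2 (defectSpace_le_LpInv Γ q hn), fun f hf => ?_⟩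
    rw [← Lp.pairing_apply, map_add, Lp.pairing_apply, Lp.pairing_apply,
      integral_mul_defectSpace hf hn, add_zero]
    exact integral_mul_eq_zero (by norm_num) hf.1 ha.1

/-! ### Duality of the invariant subspaces -/

/-- Integration against invariant functions, as functionals on the invariant subspace. -/
def invPairing (Γ : Subgroup diskAut) (p q : ℝ≥0∞) [Fact (1 ≤ p)] [Fact (1 ≤ q)]
    [ENNReal.HolderConjugate p q] : LpInv Γ q →ₗ[ℂ] StrongDual ℂ (LpInv Γ p) where
  toFun g := ((Lp.pairing p q).flip (g : Lp ℂ q m)) ∘L (LpInv Γ p).subtypeL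
  map_add' g h := by ext; simp
  map_smul' c g := by ext; simp

theorem invPairing_apply (g : LpInv Γ q) (f : LpInv Γ p) :
    invPairing Γ p q g f = ∫ z, (f : Lp ℂ p m) z * (g : Lp ℂ q m) z ∂m :=
  Lp.pairing_apply _ _

/-- For the lower bound, an arbitrary `f` in `L^p` is replaced by `Ψ f`, which gives the same
integral against an invariant `g` and has no larger norm. -/
theorem norm_invPairing (hp : p ≠ ∞) (g : LpInv Γ q) : ‖invPairing Γ p q g‖ = ‖g‖ := by
  apply le_antisymm
  · refine ContinuousLinearMap.opNorm_le_bound _ (norm_nonneg _) fun f => ?_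
    rw [invPairing_apply, mul_comm]
    exact Lp.norm_pairing_le _ _
  · refine Lp.norm_le_of_forall_pairing_le (g := (g : Lp ℂ q m)) hp (ContinuousLinearMap.opNorm_nonneg _) fun f => ?_
    rw [← integral_Psi_mul f g.2, ← invPairing_apply g ⟨_, Psi_mem_LpInv Γ f⟩]
    refine (ContinuousLinearMap.le_opNorm _ _).trans ?_
    exact mul_le_mul_of_nonneg_left (norm_Psi_le Γ f) (ContinuousLinearMap.opNorm_nonneg _)

/-- Extend the functional to `L^p` by Hahn-Banach, represent it by `g`, and replace `g` by `Ψ g`. -/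
theorem invPairing_surjective (hp : p ≠ ∞) : Function.Surjective (invPairing Γ p q) := by
  intro φ
  obtain ⟨ψ, hψ, -⟩ := exists_extension_norm_eq (LpInv Γ p) φ
  obtain ⟨g, hg⟩ := Lp.exists_eq_integral (q := q) hp ψ
  refine ⟨⟨Psi Γ q g, Psi_mem_LpInv Γ g⟩, ?_⟩
  ext f
  rw [invPairing_apply, ← hψ, hg]
  exact integral_mul_comm_Psi f.2 g

end Annihilators

end FuchsianHardy
end

open FuchsianHardy
theorem proposition3p1 (Γ : Subgroup diskAut) (hΓ : IsAdmissible Γ) :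
    (∀ (p : ℝ≥0∞) [Fact (1 ≤ p)],
      Psi Γ p '' (Hp p : Set (Lp ℂ p m)) = (HpInv Γ p ⊔ defectSpace Γ p : Submodule ℂ (Lp ℂ p m))) ∧
    (∀ (p q : ℝ≥0∞) [Fact (1 ≤ p)] [Fact (1 ≤ q)], p ≠ ∞ → ENNReal.HolderConjugate p q →
      (∃ Φ : LpInv Γ q ≃ₗᵢ[ℂ] StrongDual ℂ (LpInv Γ p),
        ∀ (g : LpInv Γ q) (f : LpInv Γ p),
          Φ g f = ∫ z, (f : Lp ℂ p m) z * (g : Lp ℂ q m) z ∂m) ∧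
      annih Γ q (HpInv Γ p : Set (Lp ℂ p m)) =
        (Hp0Inv Γ q ⊔ defectSpace Γ q : Submodule ℂ (Lp ℂ q m)) ∧
      annih Γ p (HpInv Γ q : Set (Lp ℂ q m)) =
        (Hp0Inv Γ p ⊔ defectSpace Γ p : Submodule ℂ (Lp ℂ p m)) ∧
      annih Γ p ((HpInv Γ q ⊔ defectSpace Γ q : Submodule ℂ (Lp ℂ q m)) : Set (Lp ℂ q m)) =
        Hp0Inv Γ p ∧
      annih Γ q ((HpInv Γ p ⊔ defectSpace Γ p : Submodule ℂ (Lp ℂ p m)) : Set (Lp ℂ p m)) =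
        Hp0Inv Γ q) := by
  refine ⟨fun p _ => Psi_image_Hp hΓ p, fun p q _ _ hp hpq => ?_⟩
  -- The annihilator lemmas hold for every conjugate pair, infinite exponents included, so
  -- preannihilators are obtained by exchanging `p` and `q`.
  have hqp : ENNReal.HolderConjugate q p := hpq.symm
  refine ⟨⟨LinearIsometryEquiv.ofSurjective ⟨invPairing Γ p q, norm_invPairing hp⟩
    (invPairing_surjective hp), fun g f => invPairing_apply g f⟩, annih_HpInv hΓ, annih_HpInv hΓ,
    annih_sup_defectSpace hΓ, annih_sup_defectSpace hΓ⟩
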